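/- Let $k$ be an algebraically closed field, let $N$ be a lattice of finite rank with dual lattice $M=\operatorname{Hom}(N,\mathbb Z)$, and let $\Sigma$ be a smooth complete fan in $N_{\mathbb R}$ with toric variety $X_\Sigma$ over $k$. Let $R(\Sigma)$ be the set of smooth fans subdividing $\Sigma$. A toric $b$-divisor on $X_\Sigma$ is a family $\boldsymbol D=(D_{\Sigma'})_{\Sigma'\in R(\Sigma)}$ of toric $\mathbb Q$-Weil divisors $D_{\Sigma'}=\sum_{\tau\in\Sigma'(1)}a_\tau D_\tau$ on $X_{\Sigma'}$ such that $\pi_*D_{\Sigma''}=D_{\Sigma'}$ whenever $\Sigma''$ is a subdivision of $\Sigma'$ with induced morphism $\pi\colon X_{\Sigma''}\to X_{\Sigma'}$. Its associated function $\tilde\phi$ on the primitive vectors of $N$ is given by $\tilde\phi(v_\tau)=-a_\tau$, where $v_\tau$ is the primitive generator of a ray $\tau$ and $a_\tau$ is the coefficient of $D_\tau$ in $D_{\Sigma'}$ for any $\Sigma'\in R(\Sigma)$ that contains $\tau$. Put $$P_{D_{\Sigma'}}=\{m\in M_{\mathbb R}\mid \langle m,v_\tau\rangle\ge -a_\tau\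 \text{for all }\tau\in\Sigma'(1)\},\qquad \Delta_{\boldsymbol D}=\bigcap_{\Sigma'\in R(\Sigma)}P_{D_{\Sigma'}},$$ and let $$H^0(X_\Sigma,\mathcal O(\boldsymbol D))=\{f\in k(X_\Sigma)^\times\mid \operatorname{div}_{\Sigma'}(f)+\lfloor D_{\Sigma'}\rfloor\ge 0\ \text{on } X_{\Sigma'}\ \text{for all }\Sigma'\in R(\Sigma)\}\cup\{0\}.$$ Then, for every toric $b$-divisor $\boldsymbol D$ on $X_\Sigma$ (not necessarily nef), $$H^0(X_\Sigma,\mathcal O(\boldsymbol D))=\bigoplus_{m\in\Delta_{\boldsymbol D}\cap M}k\cdot\chi^m$$ as subsets of $k(X_\Sigma)$, and $\Delta_{\boldsymbol D}=\{m\in M_{\mathbb R}\mid \langle m,v\rangle\ge\tilde\phi(v)\ \text{for all primitive } v\in N\}$. -/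

import Mathlib

open scoped TensorProduct

namespace ToricB

noncomputable section

/-! ### Lattices and fans -/

/-- The dual lattice `M = Hom(N, ℤ)`. -/
abbrev DualLattice (N : Type*) [AddCommGroup N] : Type _ := Module.Dual ℤ N

/-- `N_ℝ = N ⊗ ℝ`. -/
abbrev NR (N : Type*) [AddCommGroup N] : Type _ := ℝ ⊗[ℤ] N

/-- `M_ℝ = M ⊗ ℝ`. -/
abbrev MR (N : Type*) [AddCommGroup N] : Type _ := ℝ ⊗[ℤ] DualLattice N

/-- The inclusion `N → N_ℝ`. -/
def toNR {N : Type*} [AddCommGroup N] (v : N) : NR N := (1 : ℝ) ⊗ₜ[ℤ] v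

/-- The inclusion `M → M_ℝ`. -/
def toMR {N : Type*} [AddCommGroup N] (m : DualLattice N) : MR N := (1 : ℝ) ⊗ₜ[ℤ] m

/-- The pairing `M_ℝ × N_ℝ → ℝ`, the `ℝ`-bilinear extension of `(m, v) ↦ m v`. -/
def pairing (N : Type*) [AddCommGroup N] : MR N →ₗ[ℝ] NR N →ₗ[ℝ] ℝ :=
  LinearMap.liftBaseChange ℝ (Module.Dual.baseChange ℝ : DualLattice N →ₗ[ℤ] Module.Dual ℝ (NR N))

theorem pairing_toMR_toNR {N : Type*} [AddCommGroup N] (m : DualLattice N) (v : N) :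
    pairing N (toMR m) (toNR v) = (m v : ℝ) := by
  simp [pairing, toMR, toNR]

/-- Primitive lattice vectors (the zero vector is not primitive, take `c = 0`). -/
def IsPrimitive {N : Type*} [AddCommGroup N] (v : N) : Prop :=
  ∀ (c : ℤ) (w : N), v = c • w → IsUnit c

/-- The ray in `N_ℝ` spanned by a lattice vector. -/
def ray {N : Type*} [AddCommGroup N] (v : N) : PointedCone ℝ (NR N) :=
  PointedCone.hull ℝ {toNR v}

/-- A rational polyhedral fan in `N_ℝ`: a finite collection of strongly convex rational polyhedral
cones, closed under passing to faces, any two of which intersect along a common face. -/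
structure Fan (N : Type*) [AddCommGroup N] where
  cones : Set (PointedCone ℝ (NR N))
  finite : cones.Finite
  rational : ∀ σ ∈ cones, ∃ s : Finset N, σ = PointedCone.hull ℝ (toNR '' (s : Set N))
  salient : ∀ σ ∈ cones, (σ : ConvexCone ℝ (NR N)).Salient
  face_mem : ∀ σ ∈ cones, ∀ τ : PointedCone ℝ (NR N), τ.IsFaceOf σ → τ ∈ cones
  inter_isFaceOf : ∀ σ ∈ cones, ∀ τ ∈ cones, (σ ⊓ τ).IsFaceOf σ ∧ (σ ⊓ τ).IsFaceOf τ

namespace Fan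

variable {N : Type*} [AddCommGroup N]

/-- The support `|Σ|`, the union of the cones. -/
def support (S : Fan N) : Set (NR N) := ⋃ σ ∈ S.cones, (σ : Set (NR N))

def IsComplete (S : Fan N) : Prop := S.support = Set.univ

/-- Every cone is generated by part of a `ℤ`-basis of `N`. -/
def IsSmooth (S : Fan N) : Prop :=
  ∀ σ ∈ S.cones, ∃ (b : Module.Basis (Fin (Module.finrank ℤ N)) ℤ N)
    (J : Set (Fin (Module.finrank ℤ N))),
      σ = PointedCone.hull ℝ ((fun i => toNR (b i)) '' J)

/-- `S'.IsSubdivision S`: the fan `S'` is a subdivision of the fan `S`. -/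
def IsSubdivision (S' S : Fan N) : Prop :=
  S'.support = S.support ∧ ∀ σ' ∈ S'.cones, ∃ σ ∈ S.cones, σ' ≤ σ

/-- The set `R(Σ)` of smooth fans subdividing `Σ`. -/
abbrev R (S : Fan N) : Type _ := {S' : Fan N // S'.IsSmooth ∧ S'.IsSubdivision S}

/-- The rays `Σ(1)`; a ray `τ` is recorded by its primitive generator `v_τ`. -/
def rays (S : Fan N) : Set N := {v | IsPrimitive v ∧ ray v ∈ S.cones}

/-- Toric Weil divisors `∑ a_τ D_τ` on `X_Σ`, `τ ∈ Σ(1)`, with coefficients in `A`. -/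
abbrev ToricDiv (S : Fan N) (A : Type*) : Type _ := S.rays → A

open scoped Classical in
/-- Push-forward of toric divisors along the toric morphism `X_{S''} → X_{S'}` given by a
subdivision `S''` of `S'`: the prime divisor `D_τ` goes to `D_τ` if `τ` is a ray of `S'`, and to `0`
(it is contracted) otherwise. -/
def pushforward {A : Type*} [Zero A] (S'' S' : Fan N) (D : S''.ToricDiv A) : S'.ToricDiv A :=
  fun v => if h : (v : N) ∈ S''.rays then D ⟨v, h⟩ else 0

/-- The polyhedron `P_D = {m ∈ M_ℝ | ⟨m, v_τ⟩ ≥ -a_τ for all τ ∈ Σ(1)}` of `D = ∑ a_τ D_τ`. -/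
def polyhedron (S : Fan N) (D : S.ToricDiv ℚ) : Set (MR N) :=
  {m | ∀ v : S.rays, -(D v : ℝ) ≤ pairing N m (toNR (v : N))}

end Fan

/-! ### Toric varieties -/

instance (N : Type*) [AddCommGroup N] : UniqueSums (DualLattice N) :=
  UniqueSums.of_injective_addHom
    ({ toFun := fun m v => m v, map_add' := fun _ _ => rfl } : DualLattice N →ₙ+ (N → ℤ))
    (fun _ _ h => LinearMap.ext fun v => congrFun h v) inferInstance

/-- The function field of every toric variety with torus `Spec k[M]`: the fraction field of the
group algebra `k[M]`. -/
abbrev FunctionField (k : Type*) [Field k] (N : Type*) [AddCommGroup N] : Type _ :=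
  FractionRing (AddMonoidAlgebra k (DualLattice N))

/-- The character `χ^m`. -/
def chi (k : Type*) [Field k] {N : Type*} [AddCommGroup N] (m : DualLattice N) :
    FunctionField k N :=
  algebraMap (AddMonoidAlgebra k (DualLattice N)) (FunctionField k N) (AddMonoidAlgebra.single m 1)

/-- The lattice points `σ^∨ ∩ M` of the dual cone. -/
def dualPoints {N : Type*} [AddCommGroup N] (σ : PointedCone ℝ (NR N)) : Set (DualLattice N) :=
  {m | ∀ x ∈ σ, 0 ≤ pairing N (toMR m) x}

/-- The lattice points `σ^⊥ ∩ M`. -/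
def perpPoints {N : Type*} [AddCommGroup N] (σ : PointedCone ℝ (NR N)) : Set (DualLattice N) :=
  {m | ∀ x ∈ σ, pairing N (toMR m) x = 0}

/-- The coordinate ring `k[σ^∨ ∩ M]` of the affine chart `U_σ`, inside the function field. -/
def chartRing (k : Type*) [Field k] {N : Type*} [AddCommGroup N] (σ : PointedCone ℝ (NR N)) :
    Subring (FunctionField k N) :=
  (Algebra.adjoin k (chi k '' dualPoints σ)).toSubring

/-- The ideal of the closed torus orbit `O(σ)` in the affine chart `U_σ`, generated by the
characters `χ^m` with `m ∈ σ^∨ ∩ M` and `m ∉ σ^⊥`. -/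
def orbitIdeal (k : Type*) [Field k] {N : Type*} [AddCommGroup N] (σ : PointedCone ℝ (NR N)) :
    Ideal (chartRing k σ) :=
  Ideal.span {x | ∃ m ∈ dualPoints σ, m ∉ perpPoints σ ∧ (x : FunctionField k N) = chi k m}

/-- The toric variety `X_Σ`, obtained by gluing the affine charts `U_σ = Spec k[σ^∨ ∩ M]`, `σ ∈ Σ`.
It is an integral separated scheme, so each of its points is determined by its local ring as a
subring of the function field, and `X_Σ` is represented as the collection of these local rings: the
localizations of the chart rings at their prime ideals. -/
def toricVariety (k : Type*) [Field k] {N : Type*} [AddCommGroup N] (S : Fan N) :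
    Set (LocalSubring (FunctionField k N)) :=
  {O | ∃ σ ∈ S.cones, ∃ (P : Ideal (chartRing k σ)) (_ : P.IsPrime),
    O = LocalSubring.ofPrime (chartRing k σ) P}

/-- The prime divisors on `X_Σ`, toric or not, given by their generic points: the points of
codimension one, i.e. those whose local ring has Krull dimension one. -/
abbrev PrimeDivisor (k : Type*) [Field k] {N : Type*} [AddCommGroup N] (S : Fan N) : Type _ :=
  {O : LocalSubring (FunctionField k N) // O ∈ toricVariety k S ∧ ringKrullDim O.toSubring = 1}

/-- `O` is the local ring at the generic point of the toric prime divisor `D_τ`, where `τ` is the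
ray spanned by `v`; `D_τ` is the closure of the orbit `O(τ)`. -/
def IsLocalRingOfToricPrime {k : Type*} [Field k] {N : Type*} [AddCommGroup N] (v : N)
    (O : LocalSubring (FunctionField k N)) : Prop :=
  ∃ _ : (orbitIdeal k (ray v)).IsPrime,
    O = LocalSubring.ofPrime (chartRing k (ray v)) (orbitIdeal k (ray v))

open scoped Classical in
/-- The order of a rational function `f` along a prime divisor with local ring `O`: write `f = a / b`
with `a, b ∈ O`, `b ≠ 0`; then `ord f = length (O / a) - length (O / b)`, independently of the
choice of `a` and `b` if `f ≠ 0`. -/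
def ordAlong {K : Type*} [Field K] (O : Subring K) (f : K) : ℤ :=
  if h : ∃ p : O × O, p.2 ≠ 0 ∧ f = (p.1 : K) / (p.2 : K) then
    ((Ring.ord O h.choose.1).toNat : ℤ) - ((Ring.ord O h.choose.2).toNat : ℤ)
  else 0

/-- Integral Weil divisors on `X_Σ`, as families of coefficients. -/
abbrev WeilDiv (k : Type*) [Field k] {N : Type*} [AddCommGroup N] (S : Fan N) : Type _ :=
  PrimeDivisor k S → ℤ

/-- The principal divisor `div_Σ(f)`. -/
def divisorOf {k : Type*} [Field k] {N : Type*} [AddCommGroup N] (S : Fan N)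
    (f : FunctionField k N) : WeilDiv k S :=
  fun E => ordAlong E.1.toSubring f

open scoped Classical in
/-- The Weil divisor `∑ a_τ D_τ` on `X_Σ`. -/
def toWeilDiv (k : Type*) [Field k] {N : Type*} [AddCommGroup N] {S : Fan N}
    (D : S.ToricDiv ℤ) : WeilDiv k S :=
  fun E => ∑ᶠ v : S.rays, if IsLocalRingOfToricPrime (v : N) E.1 then D v else 0

/-! ### Toric b-divisors -/

/-- A toric (Weil) `b`-divisor on `X_Σ`, an element of the inverse limit over `R(Σ)` of the groups of
toric `ℚ`-Weil divisors under push-forward. -/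
structure ToricBDivisor {N : Type*} [AddCommGroup N] (S : Fan N) where
  /-- The incarnation `D_{Σ'}` on the model `X_{Σ'}`. -/
  inc : ∀ S' : S.R, S'.1.ToricDiv ℚ
  compat : ∀ S'' S' : S.R, S''.1.IsSubdivision S'.1 →
    Fan.pushforward S''.1 S'.1 (inc S'') = inc S'

/-- Families of integral Weil divisors on the models `X_{Σ'}`, `Σ' ∈ R(Σ)`, ordered
coefficientwise. -/
abbrev WeilFamily (k : Type*) [Field k] {N : Type*} [AddCommGroup N] (S : Fan N) : Type _ :=
  ∀ S' : S.R, WeilDiv k S'.1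

/-- The `b`-divisor `b-div(f)` of a rational function. -/
def bdiv {k : Type*} [Field k] {N : Type*} [AddCommGroup N] (S : Fan N)
    (f : FunctionField k N) : WeilFamily k S :=
  fun S' => divisorOf S'.1 f

namespace ToricBDivisor

variable {N : Type*} [AddCommGroup N] {S : Fan N}

/-- `⌊D⌋ = (⌊D_{Σ'}⌋)_{Σ'}`. -/
def floor (k : Type*) [Field k] (D : ToricBDivisor S) : WeilFamily k S :=
  fun S' => toWeilDiv k (fun v => ⌊D.inc S' v⌋)

/-- The space of global sections
`H⁰(X_Σ, O(D)) = {f ∈ k(X_Σ)ˣ | b-div(f) + ⌊D⌋ ≥ 0} ∪ {0}`. -/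
def globalSections (k : Type*) [Field k] (D : ToricBDivisor S) : Set (FunctionField k N) :=
  {f | f ≠ 0 ∧ 0 ≤ bdiv S f + D.floor k} ∪ {0}

/-- The convex set `Δ_D`, the intersection of the polyhedra `P_{D_{Σ'}}`, `Σ' ∈ R(Σ)`. -/
def Delta (D : ToricBDivisor S) : Set (MR N) :=
  ⋂ S' : S.R, S'.1.polyhedron (D.inc S')

open scoped Classical in
/-- The values on primitive vectors of the conical function `φ̃` associated with `D`: take any
`Σ' ∈ R(Σ)` that has the ray `τ` spanned by `v`; then `φ̃(v) = -a_τ`, where `a_τ` is the coefficient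
of `D_τ` in `D_{Σ'}`. -/
def phi (D : ToricBDivisor S) (v : N) : ℚ :=
  if h : ∃ S' : S.R, v ∈ S'.1.rays then -(D.inc h.choose ⟨v, h.choose_spec⟩) else 0

end ToricBDivisor

end

end ToricB

/-! Sections. On any model the prime divisors are of two kinds (`PrimeDivisor.chi_mem_or_toric`):
those meeting the torus, on which every character is regular and a toric divisor has coefficient 0,
and the toric ones `D_v`. If `f` is a section, then on `X_Σ` itself it has no pole along divisors of
the first kind. Since `k[M]` is factorial, an irreducible factor of the denominator of `f` would
give such a pole, so `f` is a Laurent polynomial (`exists_fromTorus_eq`). Along `D_v` a Laurent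
polynomial has order `min m v` over its exponents `m` (`ordAlong_toricPrime`). Hence the remaining
conditions are `m v + ⌊a_v⌋ ≥ 0` for each exponent separately, over all rays of all models. As `m v`
is an integer the floor can be dropped, and this says `m ∈ Δ_D` (`toMR_mem_Delta`). Directness of
the sum is the linear independence of characters.

The polyhedron. `Δ_D` is cut out by one inequality for each ray of each model, so two facts about
smooth fans suffice: every primitive vector spans a ray of some model (`Fan.exists_mem_rays`), and
its coefficient does not depend on the model (`ToricBDivisor.inc_eq`). The second needs two models
to have a common smooth refinement. Both are obtained by star subdivisions at two-dimensional cones,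
which preserve smoothness. For this purpose a smooth fan is replaced by the simplicial complex of
its generator sets (`SmoothComplex`), and geometry becomes bookkeeping of coefficients. -/

open scoped TensorProduct

namespace ToricB

noncomputable section

/-! ### Unimodular cones -/

section Cones

variable {N : Type*} [AddCommGroup N]

/-- The linear combination `∑ c_v v` in `N_ℝ`. -/
def ev (N : Type*) [AddCommGroup N] : (N →₀ ℝ) →ₗ[ℝ] NR N := Finsupp.linearCombination ℝ toNR

@[simp] theorem ev_single (v : N) (r : ℝ) : ev N (Finsupp.single v r) = r • toNR v := by
  simp [ev]

theorem toNR_add (v w : N) : toNR (v + w) = toNR v + toNR w := TensorProduct.tmul_add _ _ _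

theorem toNR_sum {ι : Type*} (s : Finset ι) (f : ι → N) :
    toNR (∑ i ∈ s, f i) = ∑ i ∈ s, toNR (f i) :=
  map_sum (AddMonoidHom.mk' toNR toNR_add) f s

theorem toNR_zsmul (n : ℤ) (v : N) : toNR (n • v) = (n : ℝ) • toNR v := by
  rw [Int.cast_smul_eq_zsmul]
  exact map_zsmul (AddMonoidHom.mk' toNR toNR_add) n v

theorem pairing_ev (m : DualLattice N) (c : N →₀ ℝ) :
    pairing N (toMR m) (ev N c) = c.sum fun v r => r * (m v : ℝ) := by
  rw [ev, Finsupp.linearCombination_apply, map_finsuppSum]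
  simp [pairing_toMR_toNR]

/-- The cone spanned by a finite set of lattice vectors. -/
def cone (A : Finset N) : PointedCone ℝ (NR N) := PointedCone.hull ℝ (toNR '' (A : Set N))

theorem ray_eq_cone (v : N) : ray v = cone {v} := by simp [ray, cone]

theorem toNR_mem_cone {A : Finset N} {v : N} (h : v ∈ A) : toNR v ∈ cone A :=
  PointedCone.subset_hull ⟨v, h, rfl⟩

theorem cone_le {A : Finset N} {C : PointedCone ℝ (NR N)} :
    cone A ≤ C ↔ ∀ v ∈ A, toNR v ∈ C := by
  rw [cone, Submodule.span_le, Set.image_subset_iff]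
  rfl

theorem cone_mono {A B : Finset N} (h : A ⊆ B) : cone A ≤ cone B :=
  cone_le.2 fun _ hv => toNR_mem_cone (h hv)

theorem ev_mem {C : PointedCone ℝ (NR N)} {c : N →₀ ℝ} (hc : 0 ≤ c)
    (h : ∀ v ∈ c.support, toNR v ∈ C) : ev N c ∈ C := by
  rw [ev, Finsupp.linearCombination_apply]
  exact C.sum_mem fun v hv => C.smul_mem (hc v) (h v hv)

theorem mem_cone {A : Finset N} {x : NR N} :
    x ∈ cone A ↔ ∃ c : N →₀ ℝ, 0 ≤ c ∧ c.support ⊆ A ∧ ev N c = x := by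
  constructor
  · intro h
    refine Submodule.span_induction
      (p := fun x _ => ∃ c : N →₀ ℝ, 0 ≤ c ∧ c.support ⊆ A ∧ ev N c = x)
      ?_ ?_ ?_ ?_ h
    · rintro _ ⟨v, hv, rfl⟩
      refine ⟨Finsupp.single v 1, by simp, ?_, by simp⟩
      exact Finsupp.support_single_subset.trans (by simpa using hv)
    · exact ⟨0, le_rfl, by simp, by simp⟩
    · rintro _ _ _ _ ⟨c, hc, hA, rfl⟩ ⟨d, hd, hB, rfl⟩
      classical
      exact ⟨c + d, add_nonneg hc hd, Finsupp.support_add.trans (Finset.union_subset hA hB),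
        map_add _ _ _⟩
    · rintro r _ _ ⟨c, hc, hA, rfl⟩
      exact ⟨(r : ℝ) • c, smul_nonneg r.2 hc, Finsupp.support_smul.trans hA, map_smul _ _ _⟩
  · rintro ⟨c, hc, hA, rfl⟩
    exact ev_mem hc fun v hv => toNR_mem_cone (hA hv)

/-- A finite set of lattice vectors that is part of a `ℤ`-basis. -/
def Unimodular (A : Finset N) : Prop :=
  ∃ b : Module.Basis (Fin (Module.finrank ℤ N)) ℤ N, (A : Set N) ⊆ Set.range b

theorem Unimodular.mono {A B : Finset N} (h : Unimodular A) (hB : B ⊆ A) : Unimodular B :=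
  let ⟨b, hb⟩ := h
  ⟨b, fun _ hx => hb (hB hx)⟩

/-- Members of a dual basis. Their integrality is what later turns real coefficients of lattice
points into integers. -/
theorem Unimodular.exists_dual {A : Finset N} (h : Unimodular A) {v : N} (hv : v ∈ A) :
    ∃ m : DualLattice N, m v = 1 ∧ ∀ w ∈ A, w ≠ v → m w = 0 := by
  obtain ⟨b, hb⟩ := h
  obtain ⟨i, rfl⟩ := hb hv
  refine ⟨b.coord i, by simp, fun w hw hne => ?_⟩
  obtain ⟨j, rfl⟩ := hb hw
  have : j ≠ i := fun h => hne (by rw [h])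
  simp [this]

theorem Unimodular.eq_zero {A : Finset N} (h : Unimodular A) {c : N →₀ ℝ} (hc : c.support ⊆ A)
    (h0 : ev N c = 0) : c = 0 := by
  ext v
  by_contra hv
  have hvA := hc (Finsupp.mem_support_iff.2 hv)
  obtain ⟨m, hm1, hm⟩ := h.exists_dual hvA
  have := pairing_ev m c
  rw [h0, map_zero, Finsupp.sum, Finset.sum_eq_single v] at this
  · simp [hm1] at this; exact hv this.symm
  · intro w hw hne
    simp [hm w (hc hw) hne]
  · intro hv'; simp at hv'; simp [hv']

theorem Unimodular.ev_inj {A : Finset N} (h : Unimodular A) {c d : N →₀ ℝ} (hc : c.support ⊆ A)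
    (hd : d.support ⊆ A) (hcd : ev N c = ev N d) : c = d := by
  classical
  exact sub_eq_zero.1 (h.eq_zero (Finsupp.support_sub.trans (Finset.union_subset hc hd))
    (by rw [map_sub, hcd, sub_self]))

theorem pairing_ev_of_dual {A : Finset N} {v : N} {m : DualLattice N} (h1 : m v = 1)
    (h0 : ∀ w ∈ A, w ≠ v → m w = 0) {c : N →₀ ℝ} (hc : c.support ⊆ A) :
    pairing N (toMR m) (ev N c) = c v := by
  rw [pairing_ev, Finsupp.sum, Finset.sum_eq_single v]
  · simp [h1]
  · intro w hw hne
    simp [h0 w (hc hw) hne]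
  · intro hv; simp at hv; simp [hv]

theorem Unimodular.isPrimitive {A : Finset N} (h : Unimodular A) {v : N} (hv : v ∈ A) :
    IsPrimitive v := by
  intro c w hcw
  obtain ⟨m, hm, -⟩ := h.exists_dual hv
  rw [hcw, map_smul, smul_eq_mul] at hm
  exact IsUnit.of_mul_eq_one _ hm

theorem IsPrimitive.ne_zero {v : N} (h : IsPrimitive v) : v ≠ 0 := by
  rintro rfl
  simpa using h 0 0 (by simp)

theorem toNR_injective [Module.Free ℤ N] : Function.Injective (toNR : N → NR N) := by
  intro v w h
  refine (Module.Free.chooseBasis ℤ N).ext_elem fun i => ?_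
  have := congrArg (pairing N (toMR ((Module.Free.chooseBasis ℤ N).coord i))) h
  simpa [pairing_toMR_toNR] using this

theorem IsPrimitive.eq_of_toNR_smul [Module.Free ℤ N] {v w : N} (hv : IsPrimitive v) {n : ℤ}
    (hn : 0 ≤ n) (h : toNR v = (n : ℝ) • toNR w) : v = w := by
  have h' : v = n • w := by
    apply toNR_injective
    rw [h, toNR_zsmul]
  have := Int.isUnit_iff.1 (hv n w h')
  have : n = 1 := by omega
  rw [h', this, one_smul]

/-- A generator `a` of `cone A` spans an extremal ray. Some `b ∈ B` occurs in an expression of `a`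
by `B`, extremality makes `b` a multiple of `a`, and primitivity makes the multiple 1. -/
theorem Unimodular.subset_of_cone_eq [Module.Free ℤ N] {A B : Finset N} (hA : Unimodular A)
    (hB : Unimodular B) (h : cone A = cone B) : A ⊆ B := by
  intro a ha
  obtain ⟨d, hd, hdB, hda⟩ := mem_cone.1 (h ▸ toNR_mem_cone ha)
  have hd0 : d ≠ 0 := by
    rintro rfl
    rw [map_zero] at hda
    exact (hA.isPrimitive ha).ne_zero (toNR_injective (hda.symm.trans (by simp [toNR])))
  obtain ⟨b, hb⟩ := Finsupp.support_nonempty_iff.2 hd0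
  have hbB := hdB hb
  obtain ⟨f, hf, hfA, hfb⟩ := mem_cone.1 (h ▸ toNR_mem_cone hbB : toNR b ∈ cone A)
  -- For `a' ≠ a` the `a'`-coordinates of the terms `d w • w` are nonnegative and sum to the
  -- `a'`-coordinate of `a`, which is 0; so `b` has none.
  have hfs : f = Finsupp.single a (f a) := by
    ext a'
    by_cases haa : a' = a
    · simp [haa]
    rw [Finsupp.single_eq_of_ne haa]
    by_contra hne
    have ha' : a' ∈ A := hfA (Finsupp.mem_support_iff.2 hne)
    obtain ⟨m, hm1, hm0⟩ := hA.exists_dual ha'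
    have h1 : ∀ w ∈ d.support, 0 ≤ d w * (m w : ℝ) := by
      intro w hw
      refine mul_nonneg (hd w) ?_
      obtain ⟨g, hg, hgA, hgw⟩ := mem_cone.1 (h ▸ toNR_mem_cone (hdB hw) : toNR w ∈ cone A)
      rw [← pairing_toMR_toNR, ← hgw, pairing_ev_of_dual hm1 hm0 hgA]
      exact hg _
    have h2 := pairing_ev m d
    rw [hda, pairing_toMR_toNR, hm0 a ha (Ne.symm haa), Int.cast_zero, Finsupp.sum] at h2
    have h3 := (Finset.sum_eq_zero_iff_of_nonneg h1).1 h2.symm b hb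
    rw [← pairing_toMR_toNR, ← hfb, pairing_ev_of_dual hm1 hm0 hfA] at h3
    exact (mul_ne_zero (Finsupp.mem_support_iff.1 hb) hne) h3
  obtain ⟨m, hm1, hm0⟩ := hA.exists_dual ha
  have hn : (m b : ℝ) = f a := by
    rw [← pairing_toMR_toNR, ← hfb, pairing_ev_of_dual hm1 hm0 hfA]
  have : b = a := by
    refine (hB.isPrimitive hbB).eq_of_toNR_smul (n := m b) ?_ ?_
    · have : 0 ≤ f a := hf a
      rw [← hn] at this
      exact_mod_cast this
    · rw [hn, ← hfb]
      conv_lhs => rw [hfs]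
      simp
  exact this ▸ hbB

theorem Unimodular.cone_inj [Module.Free ℤ N] {A B : Finset N} (hA : Unimodular A)
    (hB : Unimodular B) (h : cone A = cone B) : A = B :=
  (hA.subset_of_cone_eq hB h).antisymm (hB.subset_of_cone_eq hA h.symm)

/-- Splitting off the term of `v` leaves a point of `C`, so the defining property of a face applies
to the two summands. -/
theorem toNR_mem_of_ev_mem {F C : PointedCone ℝ (NR N)} (hF : F.IsFaceOf C) {c : N →₀ ℝ}
    (hc : 0 ≤ c) (hC : ∀ v ∈ c.support, toNR v ∈ C) (h : ev N c ∈ F) {v : N} (hv : v ∈ c.support) :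
    toNR v ∈ F := by
  classical
  have hpos : 0 < c v := lt_of_le_of_ne (hc v) (Ne.symm (Finsupp.mem_support_iff.1 hv))
  refine hF.mem_of_smul_add_mem (y := ev N (c.erase v)) (hC v hv) ?_ hpos ?_
  · refine ev_mem (fun w => ?_) fun w hw => ?_
    · by_cases hwv : w = v
      · simp [hwv]
      · simpa [Finsupp.erase_ne hwv] using hc w
    · rw [Finsupp.support_erase] at hw
      exact hC w (Finset.mem_of_mem_erase hw)
  · rwa [← ev_single, ← map_add, Finsupp.single_add_erase]

/-- Coefficients over `A` are unique and nonnegative, so they cannot cancel: if `t • x + y` is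
supported on `B`, so is `x`. -/
theorem Unimodular.cone_isFaceOf {A B : Finset N} (hA : Unimodular A) (hB : B ⊆ A) :
    (cone B).IsFaceOf (cone A) := by
  classical
  refine ⟨cone_mono hB, fun {x y t} hx hy ht hxy => ?_⟩
  obtain ⟨c, hc, hcA, rfl⟩ := mem_cone.1 hx
  obtain ⟨d, hd, hdA, rfl⟩ := mem_cone.1 hy
  obtain ⟨e, he, heB, hexy⟩ := mem_cone.1 hxy
  have key : t • c + d = e := by
    refine hA.ev_inj ?_ (heB.trans hB) (by rw [hexy, map_add, map_smul])
    exact Finsupp.support_add.trans (Finset.union_subset (Finsupp.support_smul.trans hcA) hdA)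
  refine mem_cone.2 ⟨c, hc, fun v hv => ?_, rfl⟩
  refine heB ?_
  rw [Finsupp.mem_support_iff, ← key]
  have h1 : 0 < c v := lt_of_le_of_ne (hc v) (Ne.symm (Finsupp.mem_support_iff.1 hv))
  have h2 := hd v
  have : 0 < t * c v := mul_pos ht h1
  simp at h2 ⊢
  linarith

theorem eq_cone_of_isFaceOf {A : Finset N} {τ : PointedCone ℝ (NR N)} (h : τ.IsFaceOf (cone A)) :
    ∃ B ⊆ A, τ = cone B := by
  classical
  refine ⟨A.filter fun a => toNR a ∈ τ, Finset.filter_subset _ _, le_antisymm (fun x hx => ?_)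
    (cone_le.2 fun v hv => (Finset.mem_filter.1 hv).2)⟩
  obtain ⟨c, hc, hcA, rfl⟩ := mem_cone.1 (h.le hx)
  exact mem_cone.2 ⟨c, hc, fun v hv => Finset.mem_filter.2 ⟨hcA hv, toNR_mem_of_ev_mem h hc
    (fun w hw => toNR_mem_cone (hcA hw)) hx hv⟩, rfl⟩

end Cones

/-! ### Smooth fans as simplicial complexes -/

/-- The combinatorial data of a smooth fan: a finite simplicial complex of unimodular sets of
lattice vectors such that a point of `N_ℝ` has at most one expression as a nonnegative combination
supported on a face. -/
structure SmoothComplex (N : Type*) [AddCommGroup N] where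
  faces : Set (Finset N)
  finite : faces.Finite
  empty_mem : ∅ ∈ faces
  down_closed : ∀ A ∈ faces, ∀ B ⊆ A, B ∈ faces
  unimodular : ∀ A ∈ faces, Unimodular A
  ev_inj : ∀ c d : N →₀ ℝ, 0 ≤ c → 0 ≤ d → c.support ∈ faces → d.support ∈ faces →
    ev N c = ev N d → c = d

theorem Fan.ext_cones {N : Type*} [AddCommGroup N] {S T : Fan N} (h : S.cones = T.cones) :
    S = T := by
  cases S; cases T; cases h; rfl

theorem Fan.IsSubdivision.refl {N : Type*} [AddCommGroup N] (S : Fan N) : S.IsSubdivision S :=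
  ⟨rfl, fun σ h => ⟨σ, h, le_rfl⟩⟩

theorem Fan.IsSubdivision.trans {N : Type*} [AddCommGroup N] {S T U : Fan N}
    (h : S.IsSubdivision T) (h' : T.IsSubdivision U) : S.IsSubdivision U := by
  refine ⟨h.1.trans h'.1, fun σ hσ => ?_⟩
  obtain ⟨τ, hτ, hle⟩ := h.2 σ hσ
  obtain ⟨ρ, hρ, hle'⟩ := h'.2 τ hτ
  exact ⟨ρ, hρ, hle.trans hle'⟩

namespace SmoothComplex

variable {N : Type*} [AddCommGroup N] (K : SmoothComplex N)

theorem cone_inf {A B : Finset N} (hA : A ∈ K.faces) (hB : B ∈ K.faces) [DecidableEq N] :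
    cone A ⊓ cone B = cone (A ∩ B) := by
  refine le_antisymm ?_ (le_inf (cone_mono Finset.inter_subset_left)
    (cone_mono Finset.inter_subset_right))
  rintro x ⟨h1, h2⟩
  obtain ⟨c, hc, hcA, rfl⟩ := mem_cone.1 h1
  obtain ⟨d, hd, hdB, hcd⟩ := mem_cone.1 h2
  have := K.ev_inj c d hc hd (K.down_closed _ hA _ hcA) (K.down_closed _ hB _ hdB) hcd.symm
  subst this
  exact mem_cone.2 ⟨c, hc, Finset.subset_inter hcA hdB, rfl⟩

/-- The fan whose cones are spanned by the faces. -/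
def toFan : Fan N where
  cones := cone '' K.faces
  finite := K.finite.image _
  rational := by
    rintro _ ⟨A, -, rfl⟩
    exact ⟨A, rfl⟩
  salient := by
    rintro _ ⟨A, hA, rfl⟩ x hx hx0 hnx
    obtain ⟨c, hc, hcA, rfl⟩ := mem_cone.1 hx
    obtain ⟨d, hd, hdA, hcd⟩ := mem_cone.1 hnx
    classical
    have h0 : c + d = 0 := (K.unimodular A hA).eq_zero
      (Finsupp.support_add.trans (Finset.union_subset hcA hdA)) (by rw [map_add, hcd]; simp)
    have : c = 0 := by
      ext v
      have h1 : 0 ≤ c v := hc v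
      have h2 : 0 ≤ d v := hd v
      have h3 := DFunLike.congr_fun h0 v
      simp at h3 ⊢
      linarith
    exact hx0 (by rw [this, map_zero])
  face_mem := by
    rintro _ ⟨A, hA, rfl⟩ τ hτ
    obtain ⟨B, hB, rfl⟩ := eq_cone_of_isFaceOf hτ
    exact ⟨B, K.down_closed A hA B hB, rfl⟩
  inter_isFaceOf := by
    rintro _ ⟨A, hA, rfl⟩ _ ⟨B, hB, rfl⟩
    classical
    rw [K.cone_inf hA hB]
    exact ⟨(K.unimodular A hA).cone_isFaceOf Finset.inter_subset_left,
      (K.unimodular B hB).cone_isFaceOf Finset.inter_subset_right⟩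

theorem cone_mem_toFan {A : Finset N} (hA : A ∈ K.faces) : cone A ∈ K.toFan.cones :=
  ⟨A, hA, rfl⟩

theorem isSmooth_toFan : K.toFan.IsSmooth := by
  rintro _ ⟨A, hA, rfl⟩
  obtain ⟨b, hb⟩ := K.unimodular A hA
  refine ⟨b, b ⁻¹' A, ?_⟩
  rw [cone]
  congr 1
  rw [← Set.image_image toNR b, Set.image_preimage_eq_of_subset hb]

theorem mem_support_toFan {x : NR N} :
    x ∈ K.toFan.support ↔ ∃ c : N →₀ ℝ, 0 ≤ c ∧ c.support ∈ K.faces ∧ ev N c = x := by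
  simp only [Fan.support, Set.mem_iUnion, exists_prop]
  constructor
  · rintro ⟨_, ⟨A, hA, rfl⟩, hx⟩
    obtain ⟨c, hc, hcA, rfl⟩ := mem_cone.1 hx
    exact ⟨c, hc, K.down_closed A hA _ hcA, rfl⟩
  · rintro ⟨c, hc, hcA, rfl⟩
    exact ⟨_, K.cone_mem_toFan hcA, mem_cone.2 ⟨c, hc, subset_rfl, rfl⟩⟩

/-- If a face spans a ray, all its vertices are proportional, so linear independence leaves only
one; it equals `v` because both are primitive. -/
theorem mem_rays_toFan {v : N} [Module.Free ℤ N] :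
    v ∈ K.toFan.rays ↔ {v} ∈ K.faces := by
  constructor
  · rintro ⟨hv, A, hA, hAv⟩
    rw [ray_eq_cone] at hAv
    have huA := K.unimodular A hA
    obtain ⟨c, hc, hcA, hcv⟩ := mem_cone.1 (hAv ▸ toNR_mem_cone (Finset.mem_singleton_self v) :
      toNR v ∈ cone A)
    have hc0 : c ≠ 0 := by
      rintro rfl
      rw [map_zero] at hcv
      exact hv.ne_zero (toNR_injective (hcv.symm.trans (by simp [toNR])))
    have hmul : ∀ a ∈ A, ∃ r : ℝ, 0 ≤ r ∧ toNR a = r • toNR v := by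
      intro a ha
      obtain ⟨d, hd, hdv, hda⟩ := mem_cone.1 (hAv ▸ toNR_mem_cone ha : toNR a ∈ cone {v})
      obtain ⟨r, rfl⟩ : ∃ r, d = Finsupp.single v r :=
        ⟨d v, Finsupp.support_subset_singleton.1 hdv⟩
      exact ⟨r, by simpa using hd v, by rw [← hda, ev_single]⟩
    obtain ⟨a, ha⟩ := Finsupp.support_nonempty_iff.2 hc0
    have haA := hcA ha
    have hsub : A = {a} := by
      refine Finset.eq_singleton_iff_unique_mem.2 ⟨haA, fun a' ha' => ?_⟩
      by_contra hne
      obtain ⟨m, hm1, hm0⟩ := huA.exists_dual ha'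
      obtain ⟨r, hr, hra⟩ := hmul a haA
      obtain ⟨r', hr', hra'⟩ := hmul a' ha'
      have e1 := congrArg (pairing N (toMR m)) hra
      have e2 := congrArg (pairing N (toMR m)) hra'
      rw [map_smul, pairing_toMR_toNR, pairing_toMR_toNR, hm0 a haA (Ne.symm hne)] at e1
      rw [map_smul, pairing_toMR_toNR, pairing_toMR_toNR, hm1] at e2
      simp at e1 e2
      rcases e1 with h | h
      · rw [h, zero_smul] at hra
        exact (huA.isPrimitive haA).ne_zero (toNR_injective (hra.trans (by simp [toNR])))
      · simp [h] at e2
    subst hsub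
    have : v = a := by
      obtain ⟨m, hm1, hm0⟩ := huA.exists_dual haA
      obtain ⟨r, rfl⟩ : ∃ r, c = Finsupp.single a r :=
        ⟨c a, Finsupp.support_subset_singleton.1 hcA⟩
      have hr : (m v : ℝ) = r := by
        rw [← pairing_toMR_toNR, ← hcv, ev_single, map_smul, pairing_toMR_toNR, hm1]
        simp
      have hr0 : 0 ≤ r := by simpa using hc a
      refine hv.eq_of_toNR_smul (n := m v) ?_ ?_
      · rw [← hr] at hr0
        exact_mod_cast hr0
      · rw [hr, ← hcv, ev_single]
    rwa [this]
  · intro h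
    exact ⟨(K.unimodular _ h).isPrimitive (Finset.mem_singleton_self v),
      ray_eq_cone v ▸ K.cone_mem_toFan h⟩

theorem exists_eq_cone {S : Fan N} (hS : S.IsSmooth) {σ : PointedCone ℝ (NR N)}
    (hσ : σ ∈ S.cones) : ∃ A : Finset N, Unimodular A ∧ σ = cone A := by
  classical
  obtain ⟨b, J, rfl⟩ := hS σ hσ
  refine ⟨J.toFinset.image b, ⟨b, by simp⟩, ?_⟩
  rw [cone]
  congr 1
  simp [Set.image_image]

/-- This transfers questions about smooth fans to complexes. For uniqueness of expressions: a point
with two expressions lies in the intersection of the two cones, a face of each that meets the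
relative interior of both. The cones therefore agree, hence so do their generators. Nonemptiness
supplies the empty face. -/
theorem exists_toFan_eq [Module.Free ℤ N] {S : Fan N} (hS : S.IsSmooth) (hne : S.cones.Nonempty) :
    ∃ K : SmoothComplex N, K.toFan = S := by
  let K : SmoothComplex N :=
    { faces := {A | Unimodular A ∧ cone A ∈ S.cones}
      finite := Set.Finite.of_finite_image (f := cone)
        (S.finite.subset (by rintro _ ⟨A, hA, rfl⟩; exact hA.2))
        (fun A hA B hB h => hA.1.cone_inj hB.1 h)
      empty_mem := by
        obtain ⟨σ, hσ⟩ := hne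
        obtain ⟨A, hA, rfl⟩ := exists_eq_cone hS hσ
        exact ⟨hA.mono (Finset.empty_subset A),
          S.face_mem _ hσ _ (hA.cone_isFaceOf (Finset.empty_subset A))⟩
      down_closed := fun A hA B hB => ⟨hA.1.mono hB, S.face_mem _ hA.2 _ (hA.1.cone_isFaceOf hB)⟩
      unimodular := fun A hA => hA.1
      ev_inj := by
        intro c d hc hd hcS hdS hcd
        have hf := S.inter_isFaceOf _ hcS.2 _ hdS.2
        have hxc : ev N c ∈ cone c.support := mem_cone.2 ⟨c, hc, subset_rfl, rfl⟩
        have hxd : ev N d ∈ cone d.support := mem_cone.2 ⟨d, hd, subset_rfl, rfl⟩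
        have h1 : cone c.support ≤ cone d.support := cone_le.2 fun v hv =>
          (toNR_mem_of_ev_mem hf.1 hc (fun w hw => toNR_mem_cone hw) ⟨hxc, hcd ▸ hxd⟩ hv).2
        have h2 : cone d.support ≤ cone c.support := cone_le.2 fun v hv =>
          (toNR_mem_of_ev_mem hf.2 hd (fun w hw => toNR_mem_cone hw) ⟨hcd ▸ hxc, hxd⟩ hv).1
        have := hcS.1.cone_inj hdS.1 (le_antisymm h1 h2)
        exact hcS.1.ev_inj subset_rfl this.ge hcd }
  refine ⟨K, Fan.ext_cones (Set.Subset.antisymm ?_ fun σ hσ => ?_)⟩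
  · rintro _ ⟨A, hA, rfl⟩
    exact hA.2
  · obtain ⟨A, hA, rfl⟩ := exists_eq_cone hS hσ
    exact ⟨A, ⟨hA, hσ⟩, rfl⟩

/-! ### Star subdivisions -/

section Star

variable {u w : N}

/-- Replace the vector `u + w` by `u` and `w` in a formal linear combination. -/
def collapse (u w : N) (c : N →₀ ℝ) : N →₀ ℝ :=
  c.erase (u + w) + Finsupp.single u (c (u + w)) + Finsupp.single w (c (u + w))

theorem ev_collapse (c : N →₀ ℝ) : ev N (collapse u w c) = ev N c := by
  conv_rhs => rw [← Finsupp.erase_add_single (u + w) c]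
  simp [collapse, toNR_add, add_assoc]

variable [DecidableEq N]

theorem ne_of_face (h : {u, w} ∈ K.faces) : u + w ≠ u ∧ u + w ≠ w := by
  have hu := ((K.unimodular _ h).isPrimitive (v := u) (by simp)).ne_zero
  have hw := ((K.unimodular _ h).isPrimitive (v := w) (by simp)).ne_zero
  simp [hu, hw]

/-- Otherwise `u + w` would have two expressions, as a vertex and as a sum along the edge. -/
theorem add_notMem_face (h : {u, w} ∈ K.faces) {A : Finset N} (hA : A ∈ K.faces) :
    u + w ∉ A := by
  intro hmem
  have he : {u + w} ∈ K.faces := K.down_closed A hA _ (by simpa using hmem)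
  have := K.ev_inj (Finsupp.single (u + w) 1) (Finsupp.single u 1 + Finsupp.single w 1)
    (by simp) (add_nonneg (by simp) (by simp)) (K.down_closed _ he _ Finsupp.support_single_subset)
    (by
      refine K.down_closed _ h _ (Finsupp.support_add.trans ?_)
      exact Finset.union_subset_union Finsupp.support_single_subset Finsupp.support_single_subset)
    (by simp [toNR_add])
  have h2 := DFunLike.congr_fun this (u + w)
  obtain ⟨h3, h4⟩ := K.ne_of_face h
  rw [Finsupp.add_apply, Finsupp.single_eq_same, Finsupp.single_eq_of_ne h3,
    Finsupp.single_eq_of_ne h4] at h2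
  norm_num at h2

/-- The faces of the star subdivision at the face `{u, w}`. -/
def starFaces (u w : N) : Set (Finset N) :=
  {A | ¬ {u, w} ⊆ A ∧ (A ∈ K.faces ∨ (u + w ∈ A ∧ A.erase (u + w) ∪ {u, w} ∈ K.faces))}

theorem collapse_nonneg {c : N →₀ ℝ} (hc : 0 ≤ c) : 0 ≤ collapse u w c := by
  refine add_nonneg (add_nonneg (fun v => ?_) (by simpa using hc _)) (by simpa using hc _)
  by_cases hv : v = u + w
  · simp [hv]
  · simpa [Finsupp.erase_ne hv] using hc v

theorem collapse_support_mem (huw : {u, w} ∈ K.faces) {c : N →₀ ℝ}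
    (h : c.support ∈ K.starFaces u w) :
    (collapse u w c).support ∈ K.faces := by
  by_cases he : u + w ∈ c.support
  · have hsub : (collapse u w c).support ⊆ c.support.erase (u + w) ∪ {u, w} := by
      rw [collapse, add_assoc]
      refine Finsupp.support_add.trans (Finset.union_subset_union (by rw [Finsupp.support_erase]) ?_)
      exact Finsupp.support_add.trans (Finset.union_subset_union Finsupp.support_single_subset
        Finsupp.support_single_subset)
    refine K.down_closed _ ?_ _ hsub
    rcases h with ⟨h1, h2 | h2⟩
    · exact absurd he (K.add_notMem_face huw h2)
    · exact h2.2
  · have h0 : c (u + w) = 0 := by simpa using he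
    have : collapse u w c = c := by
      rw [collapse, h0]
      simp only [Finsupp.single_zero, add_zero]
      exact Finsupp.erase_of_notMem_support he
    rw [this]
    rcases h with ⟨h1, h2 | h2⟩
    · exact h2
    · exact absurd h2.1 he

end Star

end SmoothComplex

/-- Replacing `u` by `u + w` is an elementary change of basis. A face of the star subdivision
through `u + w` omits `u` or `w`, so it is covered by this lemma up to exchanging the two. -/
theorem Unimodular.transvection {N : Type*} [AddCommGroup N] [DecidableEq N] {A F : Finset N}
    (hF : Unimodular F) {u w : N} (hu : u ∈ F) (hw : w ∈ F) (hne : u ≠ w)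
    (hA : A ⊆ insert (u + w) (F.erase u)) : Unimodular A := by
  obtain ⟨b, hb⟩ := hF
  obtain ⟨i, rfl⟩ := hb hu
  obtain ⟨j, rfl⟩ := hb hw
  have hij : j ≠ i := fun h => hne (by rw [h])
  have h0 : b.coord i (b j) = 0 := by simp [hij]
  refine ⟨b.map (LinearEquiv.transvection h0), fun x hx => ?_⟩
  rcases Finset.mem_insert.1 (hA hx) with rfl | hx
  · exact ⟨i, by simp [LinearMap.transvection.apply]⟩
  · obtain ⟨hxi, hxF⟩ := Finset.mem_erase.1 hx
    obtain ⟨l, rfl⟩ := hb hxF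
    have hl : l ≠ i := fun h => hxi (by rw [h])
    exact ⟨l, by simp [LinearMap.transvection.apply, hl]⟩

namespace SmoothComplex

variable {N : Type*} [AddCommGroup N] [DecidableEq N] (K : SmoothComplex N) {u w : N}

theorem collapse_apply_left (h : {u, w} ∈ K.faces) (hne : u ≠ w) (c : N →₀ ℝ) :
    collapse u w c u = c u + c (u + w) := by
  simp [collapse, Finsupp.erase_ne (K.ne_of_face h).1.symm, hne]

theorem collapse_apply_right (h : {u, w} ∈ K.faces) (hne : u ≠ w) (c : N →₀ ℝ) :
    collapse u w c w = c w + c (u + w) := by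
  simp [collapse, Finsupp.erase_ne (K.ne_of_face h).2.symm, hne.symm]

/-- A face of the star subdivision omits `u` or `w`, so one of `c u`, `c w` vanishes. Thus
`collapse` loses no information on such combinations, and uniqueness of expressions passes to the
star subdivision. -/
theorem apply_add_eq_min (h : {u, w} ∈ K.faces) (hne : u ≠ w) {c : N →₀ ℝ} (hc : 0 ≤ c)
    (hcs : c.support ∈ K.starFaces u w) :
    c (u + w) = min (collapse u w c u) (collapse u w c w) := by
  rw [K.collapse_apply_left h hne, K.collapse_apply_right h hne, min_add_add_right]
  have h1 : 0 ≤ c u := hc u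
  have h2 : 0 ≤ c w := hc w
  have : c u = 0 ∨ c w = 0 := by
    by_contra hcon
    push Not at hcon
    refine hcs.1 fun x hx => ?_
    rcases Finset.mem_insert.1 hx with rfl | hx
    · simpa using hcon.1
    · rw [Finset.mem_singleton.1 hx]; simpa using hcon.2
  rcases this with h0 | h0
  · simp [h0, h2]
  · simp [h0, h1]

/-- The star subdivision at the two-dimensional cone spanned by `u` and `w`, with new ray
generator `u + w`. -/
def star (u w : N) (hne : u ≠ w) (h : {u, w} ∈ K.faces) : SmoothComplex N where
  faces := K.starFaces u w
  finite := by
    refine (K.finite.union (K.finite.image (insert (u + w)))).subset ?_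
    rintro A ⟨-, hA | ⟨he, hA⟩⟩
    · exact Or.inl hA
    · exact Or.inr ⟨A.erase (u + w), K.down_closed _ hA _ Finset.subset_union_left,
        Finset.insert_erase he⟩
  empty_mem := ⟨fun hsub => by simpa using hsub (Finset.mem_insert_self u {w}), Or.inl K.empty_mem⟩
  down_closed := by
    rintro A ⟨h1, hA⟩ B hB
    refine ⟨fun h2 => h1 (h2.trans hB), ?_⟩
    rcases hA with hA | ⟨he, hA⟩
    · exact Or.inl (K.down_closed A hA B hB)
    · by_cases heB : u + w ∈ B
      · exact Or.inr ⟨heB, K.down_closed _ hA _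
          (Finset.union_subset_union_left (Finset.erase_subset_erase _ hB))⟩
      · refine Or.inl (K.down_closed _ hA _ fun x hx => Finset.mem_union_left _
          (Finset.mem_erase.2 ⟨?_, hB hx⟩))
        rintro rfl
        exact heB hx
  unimodular := by
    rintro A ⟨h1, hA | ⟨he, hA⟩⟩
    · exact K.unimodular A hA
    · have hF := K.unimodular _ hA
      by_cases hu : u ∈ A
      · have hw : w ∉ A := fun hw => h1 (by simp [Finset.insert_subset_iff, hu, hw])
        refine hF.transvection (u := w) (w := u) (by simp) (by simp) hne.symm fun x hx => ?_
        have hxw : x ≠ w := fun hxw => hw (hxw ▸ hx)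
        by_cases hxe : x = u + w
        · simp [hxe, add_comm]
        · simp [hx, hxw, hxe]
      · refine hF.transvection (u := u) (w := w) (by simp) (by simp) hne fun x hx => ?_
        have hxu : x ≠ u := fun hxu => hu (hxu ▸ hx)
        by_cases hxe : x = u + w
        · simp [hxe]
        · simp [hx, hxu, hxe]
  ev_inj := by
    intro c d hc hd hcs hds hcd
    have key : collapse u w c = collapse u w d := by
      refine K.ev_inj _ _ (collapse_nonneg hc) (collapse_nonneg hd)
        (K.collapse_support_mem h hcs) (K.collapse_support_mem h hds) ?_
      rw [ev_collapse, ev_collapse, hcd]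
    have he : c (u + w) = d (u + w) := by
      rw [K.apply_add_eq_min h hne hc hcs, K.apply_add_eq_min h hne hd hds, key]
    rw [collapse, collapse, he] at key
    have key' := add_right_cancel (add_right_cancel key)
    rw [← Finsupp.erase_add_single (u + w) c, ← Finsupp.erase_add_single (u + w) d, key', he]

theorem star_isSubdivision (hne : u ≠ w) (h : {u, w} ∈ K.faces) :
    (K.star u w hne h).toFan.IsSubdivision K.toFan := by
  refine ⟨Set.ext fun x => ?_, ?_⟩
  · rw [mem_support_toFan, mem_support_toFan]
    constructor
    · rintro ⟨c, hc, hcs, rfl⟩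
      exact ⟨collapse u w c, collapse_nonneg hc, K.collapse_support_mem h hcs, ev_collapse c⟩
    · rintro ⟨c, hc, hcs, rfl⟩
      have hce : c (u + w) = 0 := by
        simpa using K.add_notMem_face h hcs
      have hcu : 0 ≤ c u := hc u
      have hcw : 0 ≤ c w := hc w
      obtain ⟨hu, hw⟩ := K.ne_of_face h
      -- The inverse of `collapse`: as much as possible of `u` and `w` is moved to `u + w`, until
      -- one of their coefficients is exhausted.
      set t := min (c u) (c w) with ht
      have ht0 : 0 ≤ t := le_min hcu hcw
      set c' : N →₀ ℝ := c - Finsupp.single u t - Finsupp.single w t + Finsupp.single (u + w) t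
        with hc'
      have hc'u : c' u = c u - t := by
        simp [hc', hne, hu.symm]
      have hc'w : c' w = c w - t := by
        simp [hc', hne.symm, hw.symm]
      have hc'e : c' (u + w) = t := by
        rw [hc', Finsupp.add_apply, Finsupp.sub_apply, Finsupp.sub_apply, hce,
          Finsupp.single_eq_of_ne hu, Finsupp.single_eq_of_ne hw, Finsupp.single_eq_same]
        ring
      have hc'x : ∀ x, x ≠ u → x ≠ w → x ≠ u + w → c' x = c x := by
        intro x h1 h2 h3
        simp [hc', h1, h2, h3]
      refine ⟨c', fun x => ?_, ⟨fun hsub => ?_, ?_⟩, ?_⟩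
      · change 0 ≤ c' x
        by_cases h1 : x = u
        · subst h1; rw [hc'u]; exact sub_nonneg.2 (min_le_left _ _)
        by_cases h2 : x = w
        · subst h2; rw [hc'w]; exact sub_nonneg.2 (min_le_right _ _)
        by_cases h3 : x = u + w
        · rw [h3, hc'e]; exact ht0
        · rw [hc'x x h1 h2 h3]; exact hc x
      · have h1 := Finsupp.mem_support_iff.1 (hsub (show u ∈ _ by simp))
        have h2 := Finsupp.mem_support_iff.1 (hsub (show w ∈ _ by simp))
        rw [hc'u] at h1
        rw [hc'w] at h2
        rcases min_choice (c u) (c w) with h3 | h3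
        · exact h1 (by rw [ht, h3, sub_self])
        · exact h2 (by rw [ht, h3, sub_self])
      · rcases ht0.eq_or_lt with h0 | hpos
        · left
          have : c' = c := by simp [hc', ← h0]
          rwa [this]
        · right
          refine ⟨by rw [Finsupp.mem_support_iff, hc'e]; exact hpos.ne', K.down_closed _ hcs _ ?_⟩
          have hu' : c u ≠ 0 := (hpos.trans_le (min_le_left _ _)).ne'
          have hw' : c w ≠ 0 := (hpos.trans_le (min_le_right _ _)).ne'
          intro x hx
          rw [Finsupp.mem_support_iff]
          by_cases h1 : x = u
          · rwa [h1]
          by_cases h2 : x = w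
          · rwa [h2]
          rcases Finset.mem_union.1 hx with hx | hx
          · obtain ⟨h3, hx⟩ := Finset.mem_erase.1 hx
            rwa [Finsupp.mem_support_iff, hc'x x h1 h2 h3] at hx
          · simp [h1, h2] at hx
      · simp [hc', toNR_add]
  · rintro _ ⟨A, ⟨h1, hA | ⟨he, hA⟩⟩, rfl⟩
    · exact ⟨cone A, K.cone_mem_toFan hA, le_rfl⟩
    · refine ⟨_, K.cone_mem_toFan hA, cone_le.2 fun v hv => ?_⟩
      by_cases hve : v = u + w
      · rw [hve, toNR_add]
        exact add_mem (toNR_mem_cone (by simp)) (toNR_mem_cone (by simp))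
      · exact toNR_mem_cone (by simp [hv, hve])

end SmoothComplex

namespace SmoothComplex

variable {N : Type*} [AddCommGroup N]

/-! ### Subdivisions with a prescribed ray -/

/-- A subtractive Euclidean algorithm. If `u` and `w` occur in `v` with `c w ≤ c u`, the star
subdivision at `{u, w}` allows `c u • u + c w • w` to be rewritten as `(c u - c w) • u + c w • (u +
w)`, which lowers the total degree by `c w`. When a single vertex is left, its coefficient is 1
because `v` is primitive. -/
theorem exists_subdivision_vertex_of_combination {v : N} (hv : IsPrimitive v) (n : ℕ) :
    ∀ (K : SmoothComplex N) (c : N →₀ ℕ), c.support ∈ K.faces → c.degree = n →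
      Finsupp.linearCombination ℕ id c = v →
      ∃ K' : SmoothComplex N, K'.toFan.IsSubdivision K.toFan ∧ {v} ∈ K'.faces := by
  classical
  induction n using Nat.strong_induction_on with
  | _ n ih =>
  intro K c hc hn hcv
  by_cases hex : ∃ u ∈ c.support, ∃ w ∈ c.support, u ≠ w
  · obtain ⟨u, w, hu, hw, hne, hle⟩ :
        ∃ u w, u ∈ c.support ∧ w ∈ c.support ∧ u ≠ w ∧ c w ≤ c u := by
      obtain ⟨u, hu, w, hw, hne⟩ := hex
      rcases le_total (c w) (c u) with h | h
      · exact ⟨u, w, hu, hw, hne, h⟩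
      · exact ⟨w, u, hw, hu, hne.symm, h⟩
    have huw : {u, w} ∈ K.faces :=
      K.down_closed _ hc _ (by simp only [Finset.insert_subset_iff, Finset.singleton_subset_iff]
                               exact ⟨hu, hw⟩)
    have hpos : 0 < c w := Nat.pos_of_ne_zero (Finsupp.mem_support_iff.1 hw)
    obtain ⟨r, hr⟩ : ∃ r : N →₀ ℕ, c = r + (Finsupp.single u (c w) + Finsupp.single w (c w)) := by
      refine ⟨c - (Finsupp.single u (c w) + Finsupp.single w (c w)),
        (tsub_add_cancel_of_le fun x => ?_).symm⟩
      by_cases hxu : x = u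
      · subst hxu; simpa [hne] using hle
      · by_cases hxw : x = w
        · subst hxw; simp [hne.symm]
        · simp [hxu, hxw]
    have hrw : r w = 0 := by
      have := DFunLike.congr_fun hr w
      simpa [hne.symm] using this
    obtain ⟨hu', hw'⟩ := K.ne_of_face huw
    obtain ⟨K', hK', hvK'⟩ := ih (r.degree + c w) (by
        rw [← hn]
        conv_rhs => rw [hr]
        simp only [map_add, Finsupp.degree_single]
        omega) (K.star u w hne huw) (r + Finsupp.single (u + w) (c w)) (by
        refine ⟨fun h => ?_, Or.inr ⟨?_, K.down_closed _ hc _ fun x hx => ?_⟩⟩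
        · have := Finsupp.mem_support_iff.1 (h (by simp : w ∈ _))
          simp [hrw, hw'.symm] at this
        · simp [hpos.ne']
        · rcases Finset.mem_union.1 hx with hx | hx
          · obtain ⟨hxe, hx⟩ := Finset.mem_erase.1 hx
            have hrx : r x ≠ 0 := by simpa [hxe] using hx
            rw [Finsupp.mem_support_iff, hr, Finsupp.add_apply]
            omega
          · rcases Finset.mem_insert.1 hx with rfl | hx
            · exact hu
            · rw [Finset.mem_singleton.1 hx]; exact hw)
        (by simp) (by
          rw [← hcv]
          conv_rhs => rw [hr]
          simp)
    exact ⟨K', hK'.trans (K.star_isSubdivision hne huw), hvK'⟩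
  · push Not at hex
    have hc0 : c ≠ 0 := by
      rintro rfl
      exact hv.ne_zero (by simpa using hcv.symm)
    obtain ⟨u, hu⟩ := Finsupp.support_nonempty_iff.2 hc0
    have hsub : c.support ⊆ {u} := fun x hx => Finset.mem_singleton.2 (hex x hx u hu)
    have hcu : c = Finsupp.single u (c u) := Finsupp.support_subset_singleton.1 hsub
    have hvu : v = (c u : ℤ) • u := by
      rw [← hcv]
      conv_lhs => rw [hcu]
      simp
    have h1 : (c u : ℤ) = 1 := by
      have := Int.isUnit_iff.1 (hv _ _ hvu)
      omega
    rw [h1, one_smul] at hvu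
    refine ⟨K, .refl _, K.down_closed _ hc _ ?_⟩
    simpa [hvu] using hu

theorem exists_subdivision_vertex [Module.Free ℤ N] (K : SmoothComplex N) {v : N}
    (hv : IsPrimitive v) (hvK : toNR v ∈ K.toFan.support) :
    ∃ K' : SmoothComplex N, K'.toFan.IsSubdivision K.toFan ∧ {v} ∈ K'.faces := by
  obtain ⟨c, hc, hcs, hcv⟩ := K.mem_support_toFan.1 hvK
  -- Each coefficient is the value at `v` of an integral dual functional, hence a natural number.
  have hint : ∀ a, ((⌊c a⌋₊ : ℕ) : ℝ) = c a := by
    intro a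
    by_cases ha : a ∈ c.support
    · obtain ⟨m, hm1, hm0⟩ := (K.unimodular _ hcs).exists_dual ha
      have h1 : (m v : ℝ) = c a := by
        rw [← pairing_toMR_toNR, ← hcv, pairing_ev_of_dual hm1 hm0 subset_rfl]
      have h2 : 0 ≤ m v := by
        have : 0 ≤ c a := hc a
        rw [← h1] at this
        exact_mod_cast this
      lift m v to ℕ using h2 with k
      rw [← h1]
      simp
    · have : c a = 0 := by simpa using ha
      simp [this]
  let c' : N →₀ ℕ := c.mapRange (fun r => ⌊r⌋₊) (by simp)
  refine exists_subdivision_vertex_of_combination hv _ K c' ?_ rfl ?_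
  · exact K.down_closed _ hcs _ Finsupp.support_mapRange
  · apply toNR_injective
    rw [← hcv, Finsupp.linearCombination_apply, Finsupp.sum_mapRange_index (by simp)]
    rw [Finsupp.sum, toNR_sum, ev, Finsupp.linearCombination_apply, Finsupp.sum]
    refine Finset.sum_congr rfl fun a _ => ?_
    conv_rhs => rw [← hint a]
    rw [← Int.cast_natCast, ← toNR_zsmul, natCast_zsmul, id]

/-! ### Subdivisions along hyperplanes and common refinements -/

/-- The linear form `m` does not change sign on any cone. -/
def SignConstant (K : SmoothComplex N) (m : DualLattice N) : Prop :=
  ∀ A ∈ K.faces, (∀ a ∈ A, 0 ≤ m a) ∨ (∀ a ∈ A, m a ≤ 0)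

open scoped Classical in
/-- The two-dimensional cones on which the linear form `m` changes sign. -/
def signChanges (K : SmoothComplex N) (m : DualLattice N) : Set (N × N) :=
  {p | {p.1, p.2} ∈ K.faces ∧ 0 < m p.1 ∧ m p.2 < 0}

theorem finite_signChanges (K : SmoothComplex N) (m : DualLattice N) :
    (K.signChanges m).Finite := by
  classical
  have hV : {v : N | {v} ∈ K.faces}.Finite :=
    K.finite.preimage (Finset.singleton_injective.injOn)
  refine (hV.prod hV).subset ?_
  rintro ⟨u, w⟩ ⟨h, -, -⟩
  exact ⟨K.down_closed _ h _ (by simp), K.down_closed _ h _ (by simp)⟩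

theorem signConstant_of_signChanges_eq_empty {K : SmoothComplex N} {m : DualLattice N}
    (h : K.signChanges m = ∅) : K.SignConstant m := by
  classical
  intro A hA
  by_contra! hcon
  obtain ⟨⟨a, ha, ha'⟩, b, hb, hb'⟩ := hcon
  have : (b, a) ∈ K.signChanges m := ⟨K.down_closed _ hA _ (by
    simp only [Finset.insert_subset_iff, Finset.singleton_subset_iff]
    exact ⟨hb, ha⟩), hb', ha'⟩
  rw [h] at this
  exact this

theorem SignConstant.of_isSubdivision {K K' : SmoothComplex N} {m : DualLattice N}
    (h : K.SignConstant m) (hK : K'.toFan.IsSubdivision K.toFan) : K'.SignConstant m := by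
  intro A' hA'
  obtain ⟨_, ⟨A, hA, rfl⟩, hle⟩ := hK.2 _ (K'.cone_mem_toFan hA')
  have key : ∀ a ∈ A', ∃ c : N →₀ ℝ, 0 ≤ c ∧ c.support ⊆ A ∧
      (m a : ℝ) = ∑ v ∈ c.support, c v * (m v : ℝ) := by
    intro a ha
    obtain ⟨c, hc, hcA, hca⟩ := mem_cone.1 (hle (toNR_mem_cone ha))
    exact ⟨c, hc, hcA, by rw [← pairing_toMR_toNR, ← hca, pairing_ev, Finsupp.sum]⟩
  refine (h A hA).imp (fun h a ha => ?_) fun h a ha => ?_ <;>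
  obtain ⟨c, hc, hcA, hca⟩ := key a ha
  · have : (0 : ℝ) ≤ m a := by
      rw [hca]
      exact Finset.sum_nonneg fun v hv => mul_nonneg (hc v) (by exact_mod_cast h v (hcA hv))
    exact_mod_cast this
  · have : (m a : ℝ) ≤ 0 := by
      rw [hca]
      exact Finset.sum_nonpos fun v hv =>
        mul_nonpos_of_nonneg_of_nonpos (hc v) (by exact_mod_cast h v (hcA hv))
    exact_mod_cast this

/-- A new sign-changing pair contains `u + w`. Putting `u` or `w` of the same sign in its place
gives an old pair, with gap at most `n + 1`. Since `m w < 0 < m u`, the new gap is smaller by at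
least 1. -/
theorem signChanges_star [DecidableEq N] {K : SmoothComplex N} {m : DualLattice N} {n : ℤ}
    (hb : ∀ p ∈ K.signChanges m, m p.1 - m p.2 ≤ n + 1) {u w : N} (hne : u ≠ w)
    (h : {u, w} ∈ K.faces) (hu : 0 < m u) (hw : m w < 0) {q : N × N}
    (hq : q ∈ (K.star u w hne h).signChanges m) :
    (q ∈ K.signChanges m ∧ q ≠ (u, w)) ∨ m q.1 - m q.2 ≤ n := by
  obtain ⟨x, y⟩ := q
  have hmem : ∀ {s t : N}, ∀ A ∈ K.faces, s ∈ A → t ∈ A → 0 < m s → m t < 0 →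
      (s, t) ∈ K.signChanges m := by
    intro s t A hA hs ht hs0 ht0
    refine ⟨K.down_closed _ hA _ ?_, hs0, ht0⟩
    simp only [Finset.insert_subset_iff, Finset.singleton_subset_iff]
    exact ⟨hs, ht⟩
  obtain ⟨hf, hx, hy⟩ := hq
  simp only at hf hx hy
  rcases hf with ⟨h1, h2 | ⟨h2, h3⟩⟩
  · refine Or.inl ⟨hmem _ h2 (by simp) (by simp) hx hy, ?_⟩
    rintro ⟨⟩
    exact h1 (fun z hz => by simpa using hz)
  · right
    have h2' : u + w = x ∨ u + w = y := by simpa using h2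
    rcases h2' with rfl | rfl
    · have hye : y ≠ u + w := fun hy' => by rw [hy'] at hy; omega
      have := hb _ (hmem _ h3 (s := u) (t := y) (by simp) (by simp [hye]) hu hy)
      simp only [map_add] at this ⊢
      omega
    · have hxe : x ≠ u + w := fun hx' => by rw [hx'] at hx; omega
      have := hb _ (hmem _ h3 (s := x) (t := w) (by simp [hxe]) (by simp) hx hw)
      simp only [map_add] at this ⊢
      omega

/-- Double induction: the outer one is on a bound for the gaps `m u - m w`, the inner one on the
number of pairs attaining that bound. Starring at a pair of maximal gap removes it and creates no
other pair of that gap. -/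
theorem exists_subdivision_signChanges_eq_empty (m : DualLattice N) (n : ℕ) :
    ∀ K : SmoothComplex N, (∀ p ∈ K.signChanges m, m p.1 - m p.2 ≤ n) →
      ∃ K' : SmoothComplex N, K'.toFan.IsSubdivision K.toFan ∧ K'.signChanges m = ∅ := by
  classical
  induction n with
  | zero =>
    intro K hK
    refine ⟨K, .refl _, Set.eq_empty_of_forall_notMem fun p hp => ?_⟩
    have := hK p hp
    have := hp.2
    simp only [Nat.cast_zero] at *
    omega
  | succ n ih =>
    have inner : ∀ (j : ℕ) (K : SmoothComplex N),
        (∀ p ∈ K.signChanges m, m p.1 - m p.2 ≤ (n : ℤ) + 1) →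
        {p ∈ K.signChanges m | m p.1 - m p.2 = (n : ℤ) + 1}.ncard = j →
        ∃ K' : SmoothComplex N, K'.toFan.IsSubdivision K.toFan ∧ K'.signChanges m = ∅ := by
      intro j
      induction j using Nat.strong_induction_on with
      | _ j ihj =>
      intro K hK hj
      have hfin : {p ∈ K.signChanges m | m p.1 - m p.2 = (n : ℤ) + 1}.Finite :=
        (K.finite_signChanges m).subset fun p hp => hp.1
      by_cases hex : ∃ p ∈ K.signChanges m, m p.1 - m p.2 = (n : ℤ) + 1
      · obtain ⟨⟨u, w⟩, hp, hpe⟩ := hex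
        obtain ⟨hf, hu, hw⟩ := id hp
        simp only at hf hu hw hpe
        have hne : u ≠ w := fun h => by rw [h] at hu; omega
        have hf' : {u, w} ∈ K.faces := K.down_closed _ hf _ (fun z hz => by simpa using hz)
        have key := fun q => signChanges_star hK hne hf' hu hw (q := q)
        obtain ⟨K', hK', hK'e⟩ := ihj _ (by
            rw [← hj]
            refine Set.ncard_lt_ncard ?_ hfin
            refine ⟨fun q hq => ?_, fun hsub => ?_⟩
            · rcases key q hq.1 with h | h
              · exact ⟨h.1, hq.2⟩
              · have := hq.2
                omega
            · have hmem := hsub (show (u, w) ∈ _ from ⟨hp, hpe⟩)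
              rcases key _ hmem.1 with h | h
              · exact h.2 rfl
              · simp only at h
                omega) (K.star u w hne hf') (fun q hq => by
            rcases key q hq with h | h
            · exact hK q h.1
            · omega) rfl
        exact ⟨K', hK'.trans (K.star_isSubdivision hne hf'), hK'e⟩
      · refine ih K fun p hp => ?_
        have h1 := hK p hp
        have h2 : m p.1 - m p.2 ≠ (n : ℤ) + 1 := fun h => hex ⟨p, hp, h⟩
        omega
    intro K hK
    exact inner _ K (by exact_mod_cast hK) rfl

theorem exists_subdivision_signConstant (K : SmoothComplex N) (m : DualLattice N) :
    ∃ K' : SmoothComplex N, K'.toFan.IsSubdivision K.toFan ∧ K'.SignConstant m := by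
  obtain ⟨B, hB⟩ := ((K.finite_signChanges m).image fun p => m p.1 - m p.2).bddAbove
  obtain ⟨K', h, h'⟩ := exists_subdivision_signChanges_eq_empty m B.toNat K fun p hp =>
    (hB ⟨p, hp, rfl⟩).trans (Int.self_le_toNat B)
  exact ⟨K', h, signConstant_of_signChanges_eq_empty h'⟩

theorem exists_subdivision_forall_signConstant (K : SmoothComplex N)
    (s : Finset (DualLattice N)) :
    ∃ K' : SmoothComplex N, K'.toFan.IsSubdivision K.toFan ∧ ∀ m ∈ s, K'.SignConstant m := by
  classical
  induction s using Finset.induction_on with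
  | empty => exact ⟨K, .refl _, by simp⟩
  | insert m s _ ih =>
    obtain ⟨K₁, h₁, hs⟩ := ih
    obtain ⟨K₂, h₂, hm⟩ := K₁.exists_subdivision_signConstant m
    refine ⟨K₂, h₂.trans h₁, fun m' hm' => ?_⟩
    rcases Finset.mem_insert.1 hm' with rfl | hm'
    · exact hm
    · exact (hs m' hm').of_isSubdivision h₂

/-- Extend each face of `L` to a lattice basis, and subdivide `K` until all the resulting coordinate
forms have constant sign on each cone. Every cone of the subdivision then lies in a cone of `L`,
since the position of one interior point decides that of the whole cone. -/
theorem exists_common_subdivision (K L : SmoothComplex N)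
    (h : K.toFan.support = L.toFan.support) :
    ∃ K' : SmoothComplex N, K'.toFan.IsSubdivision K.toFan ∧ K'.toFan.IsSubdivision L.toFan := by
  classical
  have : Nonempty (Module.Basis (Fin (Module.finrank ℤ N)) ℤ N) :=
    ⟨(L.unimodular ∅ L.empty_mem).choose⟩
  choose! b hb using L.unimodular
  have hfin : (⋃ A ∈ L.faces, Set.range fun i => (b A).coord i).Finite :=
    L.finite.biUnion fun A _ => Set.finite_range _
  obtain ⟨K', hK', hs⟩ := K.exists_subdivision_forall_signConstant hfin.toFinset
  refine ⟨K', hK', hK'.1.trans h, ?_⟩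
  rintro _ ⟨B, hB, rfl⟩
  -- The sum of the generators is interior to `cone B`; the support `A` of its expression over `L`
  -- is the face whose cone will contain `cone B`.
  let d : N →₀ ℝ := ∑ v ∈ B, Finsupp.single v 1
  have hd : ev N d = ∑ v ∈ B, toNR v := by simp [d]
  have hx : ev N d ∈ L.toFan.support := by
    rw [← h, ← hK'.1]
    simp only [Fan.support, Set.mem_iUnion, exists_prop]
    refine ⟨cone B, K'.cone_mem_toFan hB, ?_⟩
    rw [hd]
    exact sum_mem fun v hv => toNR_mem_cone hv
  obtain ⟨c, hc, hcA, hcd⟩ := L.mem_support_toFan.1 hx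
  set A := c.support with hA
  refine ⟨cone A, L.cone_mem_toFan hcA, cone_le.2 fun v hv => ?_⟩
  have hpair : ∀ i, ((∑ v ∈ B, (b A).coord i v : ℤ) : ℝ) = c (b A i) := by
    intro i
    have h1 : pairing N (toMR ((b A).coord i)) (ev N d) = c (b A i) := by
      rw [← hcd, pairing_ev_of_dual (A := A) (v := b A i) (by simp) ?_ subset_rfl]
      intro z hz hzi
      obtain ⟨j, rfl⟩ := hb A hcA hz
      have : j ≠ i := fun h => hzi (by rw [h])
      simp [this]
    rw [← h1, hd, map_sum]
    simp [pairing_toMR_toNR]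
  -- The values of a coordinate form on `B` share one sign and add up to `c (b A i) ≥ 0`. They are
  -- thus all nonnegative, and all zero when the sum is.
  have hsign : ∀ i, 0 ≤ (b A).coord i v ∧ (c (b A i) = 0 → (b A).coord i v = 0) := by
    intro i
    have hcn : (0 : ℝ) ≤ c (b A i) := hc _
    have hsum : 0 ≤ ∑ v ∈ B, (b A).coord i v := by
      rw [← hpair] at hcn
      exact_mod_cast hcn
    have hmem : (b A).coord i ∈ hfin.toFinset := by
      rw [Set.Finite.mem_toFinset]
      simp only [Set.mem_iUnion]
      exact ⟨A, hcA, i, rfl⟩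
    rcases hs _ hmem B hB with hpos | hneg
    · refine ⟨hpos v hv, fun h0 => ?_⟩
      have : ∑ v ∈ B, (b A).coord i v = 0 := by
        have := hpair i
        rw [h0] at this
        exact_mod_cast this
      exact (Finset.sum_eq_zero_iff_of_nonneg hpos).1 this v hv
    · have h0 : ∑ v ∈ B, (b A).coord i v = 0 := le_antisymm (Finset.sum_nonpos hneg) hsum
      have := (Finset.sum_eq_zero_iff_of_nonpos hneg).1 h0 v hv
      exact ⟨this.ge, fun _ => this⟩
  have hv' : toNR v = ∑ i, ((b A).coord i v : ℝ) • toNR (b A i) := by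
    conv_lhs => rw [← (b A).sum_repr v]
    rw [toNR_sum]
    simp [toNR_zsmul]
  rw [hv']
  refine sum_mem fun i _ => ?_
  by_cases h0 : c (b A i) = 0
  · rw [(hsign i).2 h0]
    simp
  · refine (cone A).smul_mem (by exact_mod_cast (hsign i).1) (toNR_mem_cone ?_)
    simpa [hA] using h0

end SmoothComplex

/-! ### The function associated with a toric b-divisor -/

section Phi

variable {N : Type*} [AddCommGroup N]

theorem Fan.IsComplete.nonempty {S : Fan N} (h : S.IsComplete) : S.cones.Nonempty := by
  have : (0 : NR N) ∈ S.support := by rw [h]; trivial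
  simp only [Fan.support, Set.mem_iUnion, exists_prop] at this
  obtain ⟨σ, hσ, -⟩ := this
  exact ⟨σ, hσ⟩

variable [Module.Free ℤ N]

theorem Fan.exists_toFan_eq_of_R {S : Fan N} (h : S.IsComplete) (S' : S.R) :
    ∃ K : SmoothComplex N, K.toFan = S'.1 :=
  SmoothComplex.exists_toFan_eq S'.2.1
    (Fan.IsComplete.nonempty (show S'.1.IsComplete from S'.2.2.1.trans h))

theorem Fan.exists_mem_rays {S : Fan N} (hsmooth : S.IsSmooth) (hcomplete : S.IsComplete) {v : N}
    (hv : IsPrimitive v) : ∃ S' : S.R, v ∈ S'.1.rays := by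
  obtain ⟨K, rfl⟩ := SmoothComplex.exists_toFan_eq hsmooth hcomplete.nonempty
  obtain ⟨K', hK', hvK'⟩ := K.exists_subdivision_vertex hv (hcomplete ▸ Set.mem_univ _)
  exact ⟨⟨K'.toFan, K'.isSmooth_toFan, hK'⟩, K'.mem_rays_toFan.2 hvK'⟩

/-- The new face expressing `v` with positive coefficients spans a cone inside some old `cone A`.
The ray of `v` meets `cone A` in a face, which must contain all vertices of the new face, so the new
cone is the ray itself. -/
theorem SmoothComplex.mem_rays_of_isSubdivision {K K' : SmoothComplex N}
    (h : K'.toFan.IsSubdivision K.toFan) {v : N} (hv : v ∈ K.toFan.rays) : v ∈ K'.toFan.rays := by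
  have hv1 := K.mem_rays_toFan.1 hv
  have hsupp : toNR v ∈ K'.toFan.support := by
    rw [h.1]
    simp only [Fan.support, Set.mem_iUnion, exists_prop]
    exact ⟨_, K.cone_mem_toFan hv1, toNR_mem_cone (Finset.mem_singleton_self v)⟩
  obtain ⟨c, hc, hcs, hcv⟩ := K'.mem_support_toFan.1 hsupp
  obtain ⟨_, ⟨A, hA, rfl⟩, hle⟩ := h.2 _ (K'.cone_mem_toFan hcs)
  have hface := K.toFan.inter_isFaceOf _ (K.cone_mem_toFan hA) _ (K.cone_mem_toFan hv1)
  have hsub : ∀ a ∈ c.support, toNR a ∈ cone {v} := by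
    intro a ha
    refine (toNR_mem_of_ev_mem hface.1 hc (fun w hw => hle (toNR_mem_cone hw)) ?_ ha).2
    refine ⟨hle (mem_cone.2 ⟨c, hc, subset_rfl, rfl⟩), ?_⟩
    rw [hcv]
    exact toNR_mem_cone (Finset.mem_singleton_self v)
  have heq : cone c.support = cone {v} := by
    refine le_antisymm (cone_le.2 hsub) (cone_le.2 fun w hw => ?_)
    rw [Finset.mem_singleton.1 hw, ← hcv]
    exact mem_cone.2 ⟨c, hc, subset_rfl, rfl⟩
  have := (K'.unimodular _ hcs).cone_inj (K.unimodular _ hv1) heq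
  exact K'.mem_rays_toFan.2 (this ▸ hcs)

theorem ToricBDivisor.inc_eq_of_isSubdivision {S : Fan N} (hcomplete : S.IsComplete)
    (D : ToricBDivisor S) {S' S'' : S.R} (h : S''.1.IsSubdivision S'.1) {v : N}
    (hv : v ∈ S'.1.rays) : ∃ hv' : v ∈ S''.1.rays, D.inc S'' ⟨v, hv'⟩ = D.inc S' ⟨v, hv⟩ := by
  have hv' : v ∈ S''.1.rays := by
    obtain ⟨K, hK⟩ := Fan.exists_toFan_eq_of_R hcomplete S'
    obtain ⟨K', hK'⟩ := Fan.exists_toFan_eq_of_R hcomplete S''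
    rw [← hK, ← hK'] at h
    rw [← hK] at hv
    exact hK' ▸ SmoothComplex.mem_rays_of_isSubdivision h hv
  refine ⟨hv', ?_⟩
  rw [← D.compat S'' S' h, Fan.pushforward, dif_pos hv']

/-- Both coefficients equal the one on a common smooth refinement, where the ray survives and is not
contracted. Hence the choice of model in `phi` is immaterial. -/
theorem ToricBDivisor.inc_eq {S : Fan N} (hcomplete : S.IsComplete)
    (D : ToricBDivisor S) (S₁ S₂ : S.R) {v : N} (hv₁ : v ∈ S₁.1.rays) (hv₂ : v ∈ S₂.1.rays) :
    D.inc S₁ ⟨v, hv₁⟩ = D.inc S₂ ⟨v, hv₂⟩ := by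
  obtain ⟨K₁, hK₁⟩ := Fan.exists_toFan_eq_of_R hcomplete S₁
  obtain ⟨K₂, hK₂⟩ := Fan.exists_toFan_eq_of_R hcomplete S₂
  obtain ⟨K, h₁, h₂⟩ := K₁.exists_common_subdivision K₂
    (by rw [hK₁, hK₂, S₁.2.2.1, S₂.2.2.1])
  rw [hK₁] at h₁
  rw [hK₂] at h₂
  let S₃ : S.R := ⟨K.toFan, K.isSmooth_toFan, h₁.trans S₁.2.2⟩
  obtain ⟨_, e₁⟩ := D.inc_eq_of_isSubdivision hcomplete (S'' := S₃) h₁ hv₁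
  obtain ⟨_, e₂⟩ := D.inc_eq_of_isSubdivision hcomplete (S'' := S₃) h₂ hv₂
  rw [← e₁, ← e₂]

theorem ToricBDivisor.phi_eq {S : Fan N} (hcomplete : S.IsComplete)
    (D : ToricBDivisor S) (S' : S.R) {v : N} (hv : v ∈ S'.1.rays) :
    D.phi v = -D.inc S' ⟨v, hv⟩ := by
  have h : ∃ S' : S.R, v ∈ S'.1.rays := ⟨S', hv⟩
  rw [ToricBDivisor.phi, dif_pos h, D.inc_eq hcomplete _ S' h.choose_spec hv]

theorem ToricBDivisor.Delta_eq {S : Fan N} (hsmooth : S.IsSmooth) (hcomplete : S.IsComplete)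
    (D : ToricBDivisor S) :
    D.Delta = {m : MR N | ∀ v : N, IsPrimitive v → (D.phi v : ℝ) ≤ pairing N m (toNR v)} := by
  ext m
  simp only [ToricBDivisor.Delta, Set.mem_iInter, Fan.polyhedron, Set.mem_ofPred_eq]
  constructor
  · intro h v hv
    obtain ⟨S', hS'⟩ := Fan.exists_mem_rays hsmooth hcomplete hv
    rw [D.phi_eq hcomplete S' hS']
    exact_mod_cast h S' ⟨v, hS'⟩
  · intro h S' v
    have := h v v.2.1
    rw [D.phi_eq hcomplete S' v.2] at this
    exact_mod_cast this

end Phi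

/-! ### Coordinate rings of affine charts -/

section Charts

variable {k : Type*} [Field k] {N : Type*} [AddCommGroup N]

/-- The inclusion of the coordinate ring `k[M]` of the torus into the function field. -/
def fromTorus (k : Type*) [Field k] (N : Type*) [AddCommGroup N] :
    AddMonoidAlgebra k (DualLattice N) →ₐ[k] FunctionField k N :=
  IsScalarTower.toAlgHom k _ _

theorem fromTorus_injective : Function.Injective (fromTorus k N) :=
  IsFractionRing.injective (AddMonoidAlgebra k (DualLattice N)) (FunctionField k N)

theorem fromTorus_single (m : DualLattice N) (r : k) :
    fromTorus k N (AddMonoidAlgebra.single m r) = r • chi k m := by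
  have : AddMonoidAlgebra.single m r = r • AddMonoidAlgebra.single m (1 : k) := by simp
  rw [this, map_smul]
  rfl

theorem chi_eq (m : DualLattice N) : chi k m = fromTorus k N (AddMonoidAlgebra.single m 1) := rfl

theorem chi_zero : chi k (0 : DualLattice N) = 1 := map_one (fromTorus k N)

theorem chi_add (m m' : DualLattice N) : chi k (m + m') = chi k m * chi k m' := by
  rw [chi_eq, chi_eq, chi_eq, ← map_mul]
  simp

theorem chi_ne_zero (m : DualLattice N) : chi k m ≠ 0 := by
  rw [chi_eq]
  exact (map_ne_zero_iff _ fromTorus_injective).2 (by simp)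

theorem chi_neg (m : DualLattice N) : chi k (-m) = (chi k m)⁻¹ := by
  refine eq_inv_of_mul_eq_one_left ?_
  rw [← chi_add, neg_add_cancel, chi_zero]

theorem chi_nsmul (n : ℕ) (m : DualLattice N) : chi k (n • m) = chi k m ^ n := by
  induction n with
  | zero => simp [chi_zero]
  | succ n ih => rw [succ_nsmul, chi_add, ih, pow_succ]

theorem chi_zsmul (n : ℤ) (m : DualLattice N) : chi k (n • m) = chi k m ^ n := by
  cases n with
  | ofNat n => simp [chi_nsmul]
  | negSucc n => rw [negSucc_zsmul, chi_neg, chi_nsmul, zpow_negSucc]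

/-- The elements of `k[M]` all of whose exponents lie in `T`. -/
def SuppIn (T : Set (DualLattice N)) (a : AddMonoidAlgebra k (DualLattice N)) : Prop :=
  ∀ m ∈ a.coeff.support, m ∈ T

theorem SuppIn.mono {T T' : Set (DualLattice N)} {a : AddMonoidAlgebra k (DualLattice N)}
    (h : SuppIn T a) (hT : T ⊆ T') : SuppIn T' a := fun m hm => hT (h m hm)

theorem suppIn_zero (T : Set (DualLattice N)) :
    SuppIn T (0 : AddMonoidAlgebra k (DualLattice N)) := by
  simp [SuppIn]

theorem suppIn_single {T : Set (DualLattice N)} {m : DualLattice N} (hm : m ∈ T) (r : k) :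
    SuppIn T (AddMonoidAlgebra.single m r) := by
  intro m' hm'
  have := Finsupp.support_single_subset hm'
  rwa [Finset.mem_singleton.1 this]

theorem SuppIn.add {T : Set (DualLattice N)} {a b : AddMonoidAlgebra k (DualLattice N)}
    (ha : SuppIn T a) (hb : SuppIn T b) : SuppIn T (a + b) := by
  classical
  intro m hm
  rcases Finset.mem_union.1 (Finsupp.support_add hm) with h | h
  · exact ha m h
  · exact hb m h

theorem SuppIn.neg {T : Set (DualLattice N)} {a : AddMonoidAlgebra k (DualLattice N)}
    (ha : SuppIn T a) : SuppIn T (-a) := by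
  intro m hm
  refine ha m ?_
  simpa using hm

theorem SuppIn.mul {T T' T'' : Set (DualLattice N)} {a b : AddMonoidAlgebra k (DualLattice N)}
    (ha : SuppIn T a) (hb : SuppIn T' b) (h : ∀ m ∈ T, ∀ m' ∈ T', m + m' ∈ T'') :
    SuppIn T'' (a * b) := by
  classical
  intro m hm
  obtain ⟨x, hx, y, hy, rfl⟩ := Finset.mem_add.1 (AddMonoidAlgebra.support_coeff_mul_subset a b hm)
  exact h x (ha x hx) y (hb y hy)

theorem SuppIn.eq_zero {T T' : Set (DualLattice N)} {a : AddMonoidAlgebra k (DualLattice N)}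
    (ha : SuppIn T a) (hb : SuppIn T' a) (h : Disjoint T T') : a = 0 := by
  rw [← AddMonoidAlgebra.coeff_eq_zero, ← Finsupp.support_eq_empty]
  exact Finset.eq_empty_of_forall_notMem fun m hm => Set.disjoint_left.1 h (ha m hm) (hb m hm)

theorem suppIn_single_mul {T : Set (DualLattice N)} {m : DualLattice N}
    {a : AddMonoidAlgebra k (DualLattice N)} :
    SuppIn T (AddMonoidAlgebra.single m 1 * a) ↔ SuppIn {m' | m + m' ∈ T} a := by
  constructor
  · intro h
    have : a = AddMonoidAlgebra.single (-m) 1 * (AddMonoidAlgebra.single m 1 * a) := by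
      rw [← mul_assoc, AddMonoidAlgebra.single_mul_single, neg_add_cancel, mul_one,
        ← AddMonoidAlgebra.one_def, one_mul]
    rw [this]
    exact (suppIn_single (Set.mem_singleton _) 1).mul h (by
      rintro _ rfl m' hm'
      simpa using hm')
  · intro h
    exact (suppIn_single (Set.mem_singleton m) 1).mul h (by
      rintro _ rfl m' hm'
      exact hm')

theorem fromTorus_mem {T : Set (DualLattice N)} {a : AddMonoidAlgebra k (DualLattice N)}
    (ha : SuppIn T a) {V : Submodule k (FunctionField k N)} (hV : ∀ m ∈ T, chi k m ∈ V) :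
    fromTorus k N a ∈ V := by
  rw [← AddMonoidAlgebra.sum_coeff_single a, Finsupp.sum, map_sum]
  refine sum_mem fun m hm => ?_
  rw [fromTorus_single]
  exact V.smul_mem _ (hV m (ha m hm))

theorem mem_span_chi {T : Set (DualLattice N)} {x : FunctionField k N} :
    x ∈ Submodule.span k (chi k '' T) ↔
      ∃ a : AddMonoidAlgebra k (DualLattice N), SuppIn T a ∧ fromTorus k N a = x := by
  constructor
  · intro h
    refine Submodule.span_induction ?_ ?_ ?_ ?_ h
    · rintro _ ⟨m, hm, rfl⟩
      exact ⟨_, suppIn_single hm 1, rfl⟩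
    · exact ⟨0, suppIn_zero T, map_zero _⟩
    · rintro _ _ - - ⟨a, ha, rfl⟩ ⟨b, hb, rfl⟩
      exact ⟨a + b, ha.add hb, map_add _ _ _⟩
    · rintro r _ - ⟨a, ha, rfl⟩
      exact ⟨r • a, fun m hm => ha m (Finsupp.support_smul hm), map_smul _ _ _⟩
  · rintro ⟨a, ha, rfl⟩
    exact fromTorus_mem ha fun m hm => Submodule.subset_span ⟨m, hm, rfl⟩

theorem zero_mem_dualPoints (σ : PointedCone ℝ (NR N)) : (0 : DualLattice N) ∈ dualPoints σ := by
  intro x _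
  simp [toMR]

theorem add_mem_dualPoints {σ : PointedCone ℝ (NR N)} {m m' : DualLattice N}
    (h : m ∈ dualPoints σ) (h' : m' ∈ dualPoints σ) : m + m' ∈ dualPoints σ := by
  intro x hx
  have : toMR (m + m') = toMR m + toMR m' := TensorProduct.tmul_add _ _ _
  rw [this, map_add, LinearMap.add_apply]
  exact add_nonneg (h x hx) (h' x hx)

theorem apply_nonneg_of_mem_dualPoints {σ : PointedCone ℝ (NR N)} {m : DualLattice N} {v : N}
    (h : m ∈ dualPoints σ) (hv : toNR v ∈ σ) : 0 ≤ m v := by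
  have := h _ hv
  rw [pairing_toMR_toNR] at this
  exact_mod_cast this

theorem mem_dualPoints_cone {A : Finset N} {m : DualLattice N} :
    m ∈ dualPoints (cone A) ↔ ∀ a ∈ A, 0 ≤ m a := by
  refine ⟨fun h a ha => apply_nonneg_of_mem_dualPoints h (toNR_mem_cone ha), fun h x hx => ?_⟩
  obtain ⟨c, hc, hcA, rfl⟩ := mem_cone.1 hx
  rw [pairing_ev]
  exact Finset.sum_nonneg fun v hv => mul_nonneg (hc v) (by exact_mod_cast h v (hcA hv))

theorem mem_chartRing {σ : PointedCone ℝ (NR N)} {x : FunctionField k N} :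
    x ∈ chartRing k σ ↔
      ∃ a : AddMonoidAlgebra k (DualLattice N), SuppIn (dualPoints σ) a ∧ fromTorus k N a = x := by
  constructor
  · intro h
    refine Algebra.adjoin_induction (s := chi k '' dualPoints σ)
      (p := fun x _ => ∃ a : AddMonoidAlgebra k (DualLattice N),
        SuppIn (dualPoints σ) a ∧ fromTorus k N a = x) ?_ ?_ ?_ ?_ h
    · rintro _ ⟨m, hm, rfl⟩
      exact ⟨_, suppIn_single hm 1, rfl⟩
    · intro r
      refine ⟨_, suppIn_single (zero_mem_dualPoints σ) r, ?_⟩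
      rw [fromTorus_single, chi_zero, Algebra.smul_def, mul_one]
    · rintro _ _ - - ⟨a, ha, rfl⟩ ⟨b, hb, rfl⟩
      exact ⟨a + b, ha.add hb, map_add _ _ _⟩
    · rintro _ _ - - ⟨a, ha, rfl⟩ ⟨b, hb, rfl⟩
      exact ⟨a * b, ha.mul hb fun _ h _ h' => add_mem_dualPoints h h', map_mul _ _ _⟩
  · rintro ⟨a, ha, rfl⟩
    exact fromTorus_mem ha (V := Subalgebra.toSubmodule (Algebra.adjoin k (chi k '' dualPoints σ)))
      fun m hm => Algebra.subset_adjoin ⟨m, hm, rfl⟩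

theorem fromTorus_mem_chartRing {σ : PointedCone ℝ (NR N)}
    {a : AddMonoidAlgebra k (DualLattice N)} :
    fromTorus k N a ∈ chartRing k σ ↔ SuppIn (dualPoints σ) a := by
  rw [mem_chartRing]
  exact ⟨fun ⟨b, hb, h⟩ => fromTorus_injective h ▸ hb, fun h => ⟨a, h, rfl⟩⟩

theorem chi_mem_chartRing {σ : PointedCone ℝ (NR N)} {m : DualLattice N}
    (hm : m ∈ dualPoints σ) : chi k m ∈ chartRing k σ :=
  fromTorus_mem_chartRing.2 (suppIn_single hm 1)

theorem linearIndependent_chi : LinearIndependent k (chi k : DualLattice N → FunctionField k N) := by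
  have h : LinearIndependent k fun m : DualLattice N => AddMonoidAlgebra.single m (1 : k) := by
    rw [linearIndependent_iff]
    intro l hl
    rw [Finsupp.linearCombination_apply] at hl
    rw [← AddMonoidAlgebra.ofCoeff_eq_zero, ← AddMonoidAlgebra.sum_coeff_single (.ofCoeff l),
      ← hl]
    simp
  exact h.map' (fromTorus k N).toLinearMap (LinearMap.ker_eq_bot.2 fromTorus_injective)

/-! ### The ideal of a toric prime divisor in a chart -/

/-- The ideal of functions vanishing on the toric divisor of a vector `v` in the cone `σ`. -/
def divisorIdeal (k : Type*) [Field k] (σ : PointedCone ℝ (NR N)) (v : N) (hv : toNR v ∈ σ) :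
    Ideal (chartRing k σ) where
  carrier := {x | ∃ a : AddMonoidAlgebra k (DualLattice N),
    SuppIn {m | m ∈ dualPoints σ ∧ 1 ≤ m v} a ∧ fromTorus k N a = x}
  add_mem' := by
    rintro x y ⟨a, ha, hx⟩ ⟨b, hb, hy⟩
    exact ⟨a + b, ha.add hb, by rw [map_add, hx, hy]; rfl⟩
  zero_mem' := ⟨0, suppIn_zero _, map_zero _⟩
  smul_mem' := by
    rintro ⟨x, hx⟩ y ⟨b, hb, hy⟩
    obtain ⟨a, ha, rfl⟩ := mem_chartRing.1 hx
    refine ⟨a * b, ha.mul hb ?_, by rw [map_mul, hy]; rfl⟩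
    rintro m hm m' ⟨hm', hv'⟩
    have := apply_nonneg_of_mem_dualPoints hm hv
    exact ⟨add_mem_dualPoints hm hm', by rw [LinearMap.add_apply]; omega⟩

theorem mk_fromTorus_mem_divisorIdeal {σ : PointedCone ℝ (NR N)} {v : N} (hv : toNR v ∈ σ)
    {a : AddMonoidAlgebra k (DualLattice N)} (ha : fromTorus k N a ∈ chartRing k σ) :
    (⟨fromTorus k N a, ha⟩ : chartRing k σ) ∈ divisorIdeal k σ v hv ↔ SuppIn {m | 1 ≤ m v} a := by
  constructor
  · rintro ⟨b, hb, h⟩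
    rw [← fromTorus_injective h]
    exact hb.mono fun m hm => hm.2
  · intro h
    exact ⟨a, fun m hm => ⟨fromTorus_mem_chartRing.1 ha m hm, h m hm⟩, rfl⟩

theorem exists_eq_add_suppIn {σ : PointedCone ℝ (NR N)} {v : N} (hv : toNR v ∈ σ)
    {a : AddMonoidAlgebra k (DualLattice N)} (ha : SuppIn (dualPoints σ) a) :
    ∃ a₀ a₁ : AddMonoidAlgebra k (DualLattice N), a = a₀ + a₁ ∧ SuppIn {m | m v = 0} a₀ ∧
      SuppIn {m | 1 ≤ m v} a₁ := by
  classical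
  refine ⟨.ofCoeff (a.coeff.filter fun m => m v = 0), .ofCoeff (a.coeff.filter fun m => ¬ m v = 0),
    ?_, ?_, ?_⟩
  · rw [← AddMonoidAlgebra.ofCoeff_add, Finsupp.filter_add_filter_not]
  · intro m hm
    simp only [Finsupp.support_filter, Finset.mem_filter] at hm
    exact hm.2
  · intro m hm
    simp only [Finsupp.support_filter, Finset.mem_filter] at hm
    have := apply_nonneg_of_mem_dualPoints (ha m hm.1) hv
    have := hm.2
    change 1 ≤ m v
    omega

/-- Grade by `m ↦ m v`. Weights on the chart ring are nonnegative and the ideal is the part of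
positive weight, so primality reduces to the weight-zero parts, which multiply in the domain `k[M]`.
-/
theorem divisorIdeal_isPrime (σ : PointedCone ℝ (NR N)) (v : N) (hv : toNR v ∈ σ) :
    (divisorIdeal k σ v hv).IsPrime := by
  refine ⟨?_, ?_⟩
  · rw [Ideal.ne_top_iff_one]
    rintro ⟨a, ha, h1⟩
    have : a = AddMonoidAlgebra.single 0 1 := fromTorus_injective (h1.trans chi_zero.symm)
    have := (ha 0 (by simp [this])).2
    simp at this
  · rintro ⟨x, hx⟩ ⟨y, hy⟩ hxy
    obtain ⟨a, ha, rfl⟩ := mem_chartRing.1 hx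
    obtain ⟨b, hb, rfl⟩ := mem_chartRing.1 hy
    have hab : SuppIn {m | 1 ≤ m v} (a * b) := by
      obtain ⟨c, hc, h⟩ := hxy
      have : c = a * b := fromTorus_injective (h.trans (map_mul _ _ _).symm)
      exact this ▸ hc.mono fun m hm => hm.2
    rw [mk_fromTorus_mem_divisorIdeal, mk_fromTorus_mem_divisorIdeal]
    obtain ⟨a₀, a₁, rfl, ha₀, ha₁⟩ := exists_eq_add_suppIn hv ha
    obtain ⟨b₀, b₁, rfl, hb₀, hb₁⟩ := exists_eq_add_suppIn hv hb
    -- The product has weight zero, yet it is `a * b` minus terms of positive weight, and `a * b`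
    -- has positive weight by assumption.
    have h0 : a₀ * b₀ = 0 := by
      refine SuppIn.eq_zero (T := {m | m v = 0}) (T' := {m | 1 ≤ m v}) (ha₀.mul hb₀ ?_) ?_ ?_
      · intro m hm m' hm'
        simp only [Set.mem_ofPred_eq, LinearMap.add_apply] at *
        omega
      · have : a₀ * b₀ = (a₀ + a₁) * (b₀ + b₁) + -(a₀ * b₁ + a₁ * (b₀ + b₁)) := by ring
        rw [this]
        refine hab.add (SuppIn.neg (SuppIn.add (ha₀.mul hb₁ ?_) (ha₁.mul hb ?_)))
        · intro m hm m' hm'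
          simp only [Set.mem_ofPred_eq, LinearMap.add_apply] at *
          omega
        · intro m hm m' hm'
          have := apply_nonneg_of_mem_dualPoints hm' hv
          simp only [Set.mem_ofPred_eq, LinearMap.add_apply] at *
          omega
      · rw [Set.disjoint_left]
        intro m hm hm'
        simp only [Set.mem_ofPred_eq] at *
        omega
    rcases mul_eq_zero.1 h0 with rfl | rfl
    · left; rwa [zero_add]
    · right; rwa [zero_add]

/-- Division by `χ^m₁` lowers the value of an exponent at `v` by 1 and keeps its values at the other
generators, so exponents with `m v ≥ 1` stay in the dual cone. -/
theorem divisorIdeal_eq_span {σ : PointedCone ℝ (NR N)} {A : Finset N} (hσ : σ = cone A) {v : N}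
    (hv : toNR v ∈ σ) {m₁ : DualLattice N} (h1 : m₁ v = 1) (h0 : ∀ w ∈ A, w ≠ v → m₁ w = 0)
    (hm₁ : chi k m₁ ∈ chartRing k σ) :
    divisorIdeal k σ v hv = Ideal.span {⟨chi k m₁, hm₁⟩} := by
  subst hσ
  refine le_antisymm ?_ ?_
  · rintro ⟨x, hx⟩ ⟨a, ha, hax⟩
    rw [Ideal.mem_span_singleton]
    have ha' : SuppIn (dualPoints (cone A)) (AddMonoidAlgebra.single (-m₁) 1 * a) := by
      rw [suppIn_single_mul]
      refine ha.mono fun m hm => mem_dualPoints_cone.2 fun w hw => ?_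
      have := mem_dualPoints_cone.1 hm.1 w hw
      have := hm.2
      by_cases hwv : w = v
      · subst hwv
        simp only [LinearMap.add_apply, LinearMap.neg_apply]
        omega
      · simp only [LinearMap.add_apply, LinearMap.neg_apply, h0 w hw hwv]
        omega
    refine ⟨⟨_, fromTorus_mem_chartRing.2 ha'⟩, Subtype.ext ?_⟩
    change x = chi k m₁ * fromTorus k N _
    rw [chi_eq, ← map_mul, ← mul_assoc, AddMonoidAlgebra.single_mul_single, add_neg_cancel,
      mul_one, ← AddMonoidAlgebra.one_def, one_mul, hax]
  · rw [Ideal.span_singleton_le_iff_mem]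
    exact (mk_fromTorus_mem_divisorIdeal hv hm₁).2
      (suppIn_single (show m₁ ∈ {m : DualLattice N | 1 ≤ m v} from h1.ge) 1)

end Charts

/-! ### Orders along principal primes -/

section Order

variable {K : Type*} [Field K]

/-- Independence of the chosen fraction follows from additivity of `Ring.ord` on products.
Finiteness of the lengths, which holds for nonzero elements in dimension at most one, is needed for
`toNat` to respect sums. -/
theorem ordAlong_div (O : Subring K) [IsNoetherianRing O] [Ring.KrullDimLE 1 O] {a b : O}
    (ha : a ≠ 0) (hb : b ≠ 0) :
    ordAlong O ((a : K) / b) = ((Ring.ord O a).toNat : ℤ) - ((Ring.ord O b).toNat : ℤ) := by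
  have h : ∃ p : O × O, p.2 ≠ 0 ∧ (a : K) / b = (p.1 : K) / (p.2 : K) := ⟨(a, b), hb, rfl⟩
  rw [ordAlong, dif_pos h]
  obtain ⟨hd, he⟩ := h.choose_spec
  generalize h.choose.1 = c at *
  generalize h.choose.2 = d at *
  have hb' : (b : K) ≠ 0 := by simpa using hb
  have hd' : (d : K) ≠ 0 := by simpa using hd
  have hmul : a * d = c * b := by
    apply Subtype.ext
    rw [div_eq_div_iff hb' hd'] at he
    exact he
  have hc : c ≠ 0 := by
    rintro rfl
    rw [zero_mul] at hmul
    exact (mul_ne_zero ha hd) hmul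
  have hord := congrArg (Ring.ord O) hmul
  rw [Ring.ord_mul _ (mem_nonZeroDivisors_of_ne_zero hd),
    Ring.ord_mul _ (mem_nonZeroDivisors_of_ne_zero hb)] at hord
  have fin : ∀ x : O, x ≠ 0 → Ring.ord O x ≠ ⊤ := fun x hx =>
    Ring.ord_ne_top (mem_nonZeroDivisors_of_ne_zero hx)
  have := congrArg ENat.toNat hord
  rw [ENat.toNat_add (fin a ha) (fin d hd), ENat.toNat_add (fin c hc) (fin b hb)] at this
  omega

theorem ordAlong_nonneg (O : Subring K) [IsNoetherianRing O] [Ring.KrullDimLE 1 O] {x : K}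
    (hx : x ∈ O) (hx0 : x ≠ 0) : 0 ≤ ordAlong O x := by
  have := ordAlong_div O (a := ⟨x, hx⟩) (b := 1) (fun h => hx0 (congrArg Subtype.val h)) one_ne_zero
  simp only [Subring.coe_one, div_one, Ring.ord_one, ENat.toNat_zero] at this
  rw [this]
  simp

theorem mem_ofPrime {A : Subring K} {P : Ideal A} [P.IsPrime] {x : K} :
    x ∈ (LocalSubring.ofPrime A P).toSubring ↔ ∃ a s : A, s ∉ P ∧ x = a / s := by
  constructor
  · intro hx
    obtain ⟨⟨a, s⟩, h⟩ := IsLocalization.surj P.primeCompl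
      (⟨x, hx⟩ : (LocalSubring.ofPrime A P).toSubring)
    refine ⟨a, s, s.2, ?_⟩
    have h' := congrArg Subtype.val h
    have hs : ((s : A) : K) ≠ 0 := fun h0 => s.2 (by
      have : (s : A) = 0 := Subtype.ext h0
      rw [this]; exact P.zero_mem)
    rw [eq_div_iff hs]
    exact h'
  · rintro ⟨a, s, hs, rfl⟩
    obtain ⟨u, hu⟩ := IsLocalization.map_units (LocalSubring.ofPrime A P).toSubring
      (⟨s, hs⟩ : P.primeCompl)
    have h1 : ((u : (LocalSubring.ofPrime A P).toSubring) : K) = s := congrArg Subtype.val hu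
    have h2 : ((u⁻¹ : (LocalSubring.ofPrime A P).toSubringˣ) :
        (LocalSubring.ofPrime A P).toSubring) = ((s : K)⁻¹ : K) := by
      refine eq_inv_of_mul_eq_one_left ?_
      rw [← h1]
      exact congrArg Subtype.val (Units.inv_mul u)
    rw [div_eq_mul_inv, ← h2]
    exact mul_mem (LocalSubring.le_ofPrime A P a.2) (Subtype.mem _)

theorem isUnit_ofPrime {A : Subring K} {P : Ideal A} [P.IsPrime] {s : A} (hs : s ∉ P) :
    IsUnit (⟨s, LocalSubring.le_ofPrime A P s.2⟩ : (LocalSubring.ofPrime A P).toSubring) :=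
  IsLocalization.map_units (LocalSubring.ofPrime A P).toSubring (⟨s, hs⟩ : P.primeCompl)

theorem isNoetherianRing_ofPrime (A : Subring K) [IsNoetherianRing A] (P : Ideal A) [P.IsPrime] :
    IsNoetherianRing (LocalSubring.ofPrime A P).toSubring :=
  IsLocalization.isNoetherianRing P.primeCompl _ inferInstance

theorem ringKrullDim_ofPrime (A : Subring K) (P : Ideal A) [P.IsPrime] :
    ringKrullDim (LocalSubring.ofPrime A P).toSubring = P.height :=
  IsLocalization.AtPrime.ringKrullDim_eq_height P _

theorem krullDimLE_one_of_eq {R : Type*} [CommRing R] (h : ringKrullDim R = 1) :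
    Ring.KrullDimLE 1 R := by
  rw [Ring.krullDimLE_iff, h]
  rfl

theorem height_eq_one_of_eq_span {R : Type*} [CommRing R] [IsDomain R] [IsNoetherianRing R]
    {P : Ideal R} [P.IsPrime] {π : R} (hπ : π ≠ 0) (hP : P = Ideal.span {π}) : P.height = 1 := by
  rw [hP]
  refine Ideal.height_span_singleton_eq_one_of_mem_nonZeroDivisors
    (mem_nonZeroDivisors_of_ne_zero hπ) ?_
  rw [← Ideal.span_singleton_eq_top, ← hP]
  exact Ideal.IsPrime.ne_top'

theorem eq_of_le_of_height_eq_one {R : Type*} [CommRing R] [IsDomain R] {P Q : Ideal R}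
    [P.IsPrime] [Q.IsPrime] (hQ : Q ≠ ⊥) (hQP : Q ≤ P) (h : P.height = 1) : Q = P := by
  by_contra hne
  have hlt := Ideal.height_add_one_le_of_lt_of_isPrime (lt_of_le_of_ne hQP hne)
  have h0 : Q.height = 0 := by
    rw [h] at hlt
    by_contra h0
    have : (1 : ℕ∞) + 1 ≤ 1 := (add_le_add_left (Order.one_le_iff_ne_zero.2 h0) 1).trans hlt
    exact absurd this (by decide)
  exact hQ (Ideal.height_eq_zero_iff_eq_bot.1 h0)

/-- A principal nonzero prime has height one, so the local ring is one-dimensional; `π` generates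
its maximal ideal and has order 1, while `s` and `t` become units. All explicit orders below come
from this formula. -/
theorem ordAlong_ofPrime_span {A : Subring K} [IsNoetherianRing A] {P : Ideal A} [P.IsPrime]
    {π : A} (hπ : π ≠ 0) (hP : P = Ideal.span {π}) {s t : A} (hs : s ∉ P) (ht : t ∉ P) (r : ℤ) :
    ordAlong (LocalSubring.ofPrime A P).toSubring ((π : K) ^ r * (s / t)) = r := by
  set O := (LocalSubring.ofPrime A P).toSubring with hO
  have : IsNoetherianRing O := isNoetherianRing_ofPrime A P
  have : Ring.KrullDimLE 1 O := krullDimLE_one_of_eq (by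
    rw [hO, ringKrullDim_ofPrime, height_eq_one_of_eq_span hπ hP]; rfl)
  have hincl : ∀ x : A, (x : K) ∈ O := fun x => LocalSubring.le_ofPrime A P x.2
  have hne : ∀ x : A, x ≠ 0 → (⟨x, hincl x⟩ : O) ≠ 0 := fun x hx h =>
    hx (Subtype.ext (congrArg (Subtype.val : O → K) h))
  have hs0 : s ≠ 0 := fun h => hs (h ▸ P.zero_mem)
  have ht0 : t ≠ 0 := fun h => ht (h ▸ P.zero_mem)
  have hπO : Ring.ord O ⟨π, hincl π⟩ = 1 := by
    rw [Ring.ord, Module.length_eq_one_iff, isSimpleModule_iff_isCoatom, ← Ideal.isMaximal_def]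
    have h1 : Ideal.span {(⟨π, hincl π⟩ : O)} = P.map (algebraMap A O) := by
      refine Eq.trans ?_ (congrArg (Ideal.map (algebraMap A O)) hP.symm)
      rw [Ideal.map_span, Set.image_singleton]
      rfl
    rw [h1, IsLocalization.AtPrime.map_eq_maximalIdeal P O]
    infer_instance
  have hsO : Ring.ord O ⟨s, hincl s⟩ = 0 := Ring.ord_of_isUnit (isUnit_ofPrime hs)
  have htO : Ring.ord O ⟨t, hincl t⟩ = 0 := Ring.ord_of_isUnit (isUnit_ofPrime ht)
  have hpow : ∀ (n : ℕ) (x : A), x ≠ 0 → Ring.ord O ⟨x, hincl x⟩ = 0 →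
      Ring.ord O (⟨π, hincl π⟩ ^ n * ⟨x, hincl x⟩) = n := by
    intro n x hx h
    rw [Ring.ord_mul _ (mem_nonZeroDivisors_of_ne_zero (hne x hx)),
      Ring.ord_pow (mem_nonZeroDivisors_of_ne_zero (hne π hπ)), h, hπO]
    simp
  cases r with
  | ofNat n =>
    have := ordAlong_div O (mul_ne_zero (pow_ne_zero n (hne π hπ)) (hne s hs0)) (hne t ht0)
    rw [hpow n s hs0 hsO, htO] at this
    simpa [mul_div_assoc] using this
  | negSucc n =>
    have := ordAlong_div O (hne s hs0) (mul_ne_zero (pow_ne_zero (n + 1) (hne π hπ)) (hne t ht0))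
    rw [hpow (n + 1) t ht0 htO, hsO] at this
    rw [zpow_negSucc, ← div_eq_inv_mul, div_div, mul_comm (t : K)]
    have hn : ((n + 1 : ℕ) : ℕ∞).toNat = n + 1 := ENat.toNat_natCast _
    rw [hn] at this
    rw [Int.negSucc_eq]
    simpa using this

end Order

/-! ### Finite generation of the charts of a smooth fan -/

section Noetherian

variable {k : Type*} [Field k] {N : Type*} [AddCommGroup N]

/-- Generators of the monoid `σ^∨ ∩ M` for a cone spanned by a part of the basis `b`. -/
def dualGenerators {ι : Type*} (b : Module.Basis ι ℤ N) (A : Finset N) : Set (DualLattice N) :=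
  Set.range b.coord ∪ {m | ∃ i, b i ∉ A ∧ m = -b.coord i}

/-- In the dual basis the coefficients of `m` are the values `m (b i)`: nonnegative where `b i ∈ A`,
unrestricted elsewhere, which is why both signs occur there. -/
theorem closure_dualGenerators {ι : Type*} [Fintype ι] (b : Module.Basis ι ℤ N) {A : Finset N}
    (hA : (A : Set N) ⊆ Set.range b) :
    (AddSubmonoid.closure (dualGenerators b A) : Set (DualLattice N)) = dualPoints (cone A) := by
  apply Set.Subset.antisymm
  · intro m hm
    refine AddSubmonoid.closure_induction (motive := fun m _ => m ∈ dualPoints (cone A)) ?_ ?_ ?_ hm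
    · rintro _ (⟨i, rfl⟩ | ⟨i, hi, rfl⟩) <;>
      refine mem_dualPoints_cone.2 fun a ha => ?_ <;>
      obtain ⟨j, rfl⟩ := hA ha
      · classical
        rw [b.coord_apply, b.repr_self, Finsupp.single_apply]
        split_ifs <;> simp
      · have : j ≠ i := fun h => hi (h ▸ ha)
        simp [this]
    · exact zero_mem_dualPoints _
    · exact fun _ _ _ _ h h' => add_mem_dualPoints h h'
  · intro m hm
    have hsum : m = ∑ i, m (b i) • b.coord i := by
      refine b.ext fun j => ?_
      simp
    rw [hsum, SetLike.mem_coe]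
    refine sum_mem fun i _ => ?_
    rcases le_or_gt 0 (m (b i)) with h | h
    · lift m (b i) to ℕ using h with n
      rw [natCast_zsmul]
      refine AddSubmonoid.nsmul_mem _ (AddSubmonoid.subset_closure ?_) n
      exact Or.inl ⟨i, rfl⟩
    · have hi : b i ∉ A := fun hi => absurd (mem_dualPoints_cone.1 hm _ hi) (by omega)
      obtain ⟨n, hn⟩ := Int.eq_ofNat_of_zero_le (a := -m (b i)) (by omega)
      have : m (b i) = -(n : ℤ) := by omega
      rw [this, neg_smul, ← smul_neg, natCast_zsmul]
      refine AddSubmonoid.nsmul_mem _ (AddSubmonoid.subset_closure ?_) n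
      exact Or.inr ⟨i, hi, rfl⟩

theorem finite_dualGenerators {ι : Type*} [Finite ι] (b : Module.Basis ι ℤ N) (A : Finset N) :
    (dualGenerators b A).Finite := by
  refine (Set.finite_range _).union ((Set.finite_range fun i => -b.coord i).subset ?_)
  rintro _ ⟨i, -, rfl⟩
  exact ⟨i, rfl⟩

theorem Unimodular.isNoetherianRing_chartRing {A : Finset N} (hA : Unimodular A) :
    IsNoetherianRing (chartRing k (cone A)) := by
  obtain ⟨b, hb⟩ := hA
  have hfg : (Algebra.adjoin k (chi k '' dualPoints (cone A))).FG := by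
    have : Algebra.adjoin k (chi k '' dualPoints (cone A)) =
        Algebra.adjoin k (chi k '' dualGenerators b A) := by
      refine le_antisymm (Algebra.adjoin_le ?_) (Algebra.adjoin_mono (Set.image_mono ?_))
      · rintro _ ⟨m, hm, rfl⟩
        rw [← closure_dualGenerators b hb] at hm
        refine AddSubmonoid.closure_induction (motive := fun m _ => chi k m ∈
          Algebra.adjoin k (chi k '' dualGenerators b A)) ?_ ?_ ?_ hm
        · exact fun m hm => Algebra.subset_adjoin ⟨m, hm, rfl⟩
        · rw [chi_zero]
          exact one_mem _
        · intro m m' _ _ h h'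
          rw [chi_add]
          exact mul_mem h h'
      · rw [← closure_dualGenerators b hb]
        exact AddSubmonoid.subset_closure
    rw [this]
    exact Subalgebra.fg_def.2 ⟨_, (finite_dualGenerators b A).image _, rfl⟩
  have : Algebra.FiniteType k (Algebra.adjoin k (chi k '' dualPoints (cone A))) :=
    (Subalgebra.fg_iff_finiteType _).1 hfg
  exact Algebra.FiniteType.isNoetherianRing k (Algebra.adjoin k (chi k '' dualPoints (cone A)))

end Noetherian

/-! ### Local rings of toric prime divisors -/

section ToricPrime

variable {k : Type*} [Field k] {N : Type*} [AddCommGroup N]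

theorem toNR_mem_ray (v : N) : toNR v ∈ ray v :=
  PointedCone.subset_hull (Set.mem_singleton _)

theorem mem_dualPoints_ray {v : N} {m : DualLattice N} : m ∈ dualPoints (ray v) ↔ 0 ≤ m v := by
  rw [ray_eq_cone, mem_dualPoints_cone]
  simp

theorem mem_perpPoints_ray {v : N} {m : DualLattice N} : m ∈ perpPoints (ray v) ↔ m v = 0 := by
  constructor
  · intro h
    have := h _ (toNR_mem_ray v)
    rw [pairing_toMR_toNR] at this
    exact_mod_cast this
  · intro h x hx
    rw [ray_eq_cone] at hx
    obtain ⟨c, -, hcA, rfl⟩ := mem_cone.1 hx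
    rw [pairing_ev]
    refine Finset.sum_eq_zero fun w hw => ?_
    simp [Finset.mem_singleton.1 (hcA hw), h]

/-- For a ray, being outside the perpendicular means having positive weight. The converse inclusion
uses that the divisor ideal is generated by one character of weight 1. -/
theorem orbitIdeal_ray_eq {v : N} (hv : Unimodular {v}) :
    orbitIdeal k (ray v) = divisorIdeal k (ray v) v (toNR_mem_ray v) := by
  refine le_antisymm (Ideal.span_le.2 ?_) ?_
  · rintro ⟨x, hx⟩ ⟨m, hm, hm', hxm⟩
    rw [mem_dualPoints_ray] at hm
    rw [mem_perpPoints_ray] at hm'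
    exact ⟨AddMonoidAlgebra.single m 1, suppIn_single
      (show m ∈ {m | m ∈ dualPoints (ray v) ∧ 1 ≤ m v} from ⟨mem_dualPoints_ray.2 hm, by omega⟩) 1,
      hxm.symm⟩
  · obtain ⟨m, hm1, hm0⟩ := hv.exists_dual (Finset.mem_singleton_self v)
    have hm : m ∈ dualPoints (ray v) := mem_dualPoints_ray.2 (by omega)
    rw [divisorIdeal_eq_span (ray_eq_cone v) _ hm1 hm0 (chi_mem_chartRing hm), Ideal.span_singleton_le_iff_mem]
    refine Ideal.subset_span ⟨m, hm, ?_, rfl⟩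
    rw [mem_perpPoints_ray]
    omega

theorem orbitIdeal_ray_isPrime {v : N} (hv : Unimodular {v}) : (orbitIdeal k (ray v)).IsPrime := by
  rw [orbitIdeal_ray_eq hv]
  exact divisorIdeal_isPrime _ _ _

theorem exists_orbitIdeal_ray_eq_span {v : N} (hv : Unimodular {v}) {m : DualLattice N}
    (hm : m v = 1) : ∃ h : chi k m ∈ chartRing k (ray v),
      orbitIdeal k (ray v) = Ideal.span {⟨chi k m, h⟩} := by
  have hm' : m ∈ dualPoints (ray v) := mem_dualPoints_ray.2 (by omega)
  refine ⟨chi_mem_chartRing hm', ?_⟩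
  rw [orbitIdeal_ray_eq hv]
  exact divisorIdeal_eq_span (ray_eq_cone v) _ hm (by simp) _

theorem Unimodular.isNoetherianRing_chartRing_ray {v : N} (hv : Unimodular {v}) :
    IsNoetherianRing (chartRing k (ray v)) := by
  rw [ray_eq_cone]
  exact hv.isNoetherianRing_chartRing

theorem mk_fromTorus_mem_orbitIdeal {v : N} (hv : Unimodular {v})
    {a : AddMonoidAlgebra k (DualLattice N)} (ha : fromTorus k N a ∈ chartRing k (ray v)) :
    (⟨fromTorus k N a, ha⟩ : chartRing k (ray v)) ∈ orbitIdeal k (ray v) ↔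
      SuppIn {m | 1 ≤ m v} a := by
  rw [orbitIdeal_ray_eq hv, mk_fromTorus_mem_divisorIdeal]

/-- The order of a Laurent polynomial along a toric prime divisor is the minimal weight of its
exponents. -/
theorem ordAlong_toricPrime {v : N} (hv : Unimodular {v}) {O : LocalSubring (FunctionField k N)}
    (hO : IsLocalRingOfToricPrime v O) {a : AddMonoidAlgebra k (DualLattice N)} (ha : a ≠ 0) :
    ∃ m ∈ a.coeff.support, (∀ m' ∈ a.coeff.support, m v ≤ m' v) ∧
      ordAlong O.toSubring (fromTorus k N a) = m v := by
  obtain ⟨hprime, rfl⟩ := hO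
  have hne : a.coeff.support.Nonempty := by
    rw [Finsupp.support_nonempty_iff]
    simpa using ha
  obtain ⟨m, hm, hmin⟩ := Finset.exists_min_image _ (fun m : DualLattice N => m v) hne
  refine ⟨m, hm, hmin, ?_⟩
  obtain ⟨m₁, hm₁, -⟩ := hv.exists_dual (Finset.mem_singleton_self v)
  obtain ⟨hmem, hspan⟩ := exists_orbitIdeal_ray_eq_span (k := k) hv hm₁
  have := hv.isNoetherianRing_chartRing_ray (k := k)
  -- Dividing by a character of weight `m v` makes the minimal weight 0, so `b` lies in the chart
  -- ring but outside the prime and is a unit in the local ring.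
  set b := AddMonoidAlgebra.single (-(m v • m₁)) 1 * a with hb
  have hbmem : fromTorus k N b ∈ chartRing k (ray v) := by
    rw [fromTorus_mem_chartRing, hb, suppIn_single_mul]
    intro m' hm'
    have := hmin m' hm'
    refine mem_dualPoints_ray.2 ?_
    simp only [LinearMap.add_apply, LinearMap.neg_apply, LinearMap.smul_apply, hm₁, smul_eq_mul]
    omega
  have hbP : (⟨fromTorus k N b, hbmem⟩ : chartRing k (ray v)) ∉ orbitIdeal k (ray v) := by
    rw [mk_fromTorus_mem_orbitIdeal hv, hb, suppIn_single_mul]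
    intro h
    have := h m hm
    simp [hm₁] at this
  have h1P : (1 : chartRing k (ray v)) ∉ orbitIdeal k (ray v) :=
    (Ideal.ne_top_iff_one _).1 hprime.ne_top
  have key := ordAlong_ofPrime_span (P := orbitIdeal k (ray v)) (π := ⟨chi k m₁, hmem⟩)
    (fun h => chi_ne_zero m₁ (congrArg Subtype.val h)) hspan hbP h1P (m v)
  rw [← key]
  congr 1
  have hzpow := zpow_ne_zero (m v) (chi_ne_zero (k := k) m₁)
  change _ = chi k m₁ ^ m v * (fromTorus k N b / 1)
  rw [hb, map_mul, ← chi_eq, chi_neg, chi_zsmul, div_one, mul_inv_cancel_left₀ hzpow]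

theorem ringKrullDim_toricPrime {v : N} (hv : Unimodular {v})
    {O : LocalSubring (FunctionField k N)} (hO : IsLocalRingOfToricPrime v O) :
    ringKrullDim O.toSubring = 1 := by
  obtain ⟨hprime, rfl⟩ := hO
  obtain ⟨m₁, hm₁, -⟩ := hv.exists_dual (Finset.mem_singleton_self v)
  obtain ⟨hmem, hspan⟩ := exists_orbitIdeal_ray_eq_span (k := k) hv hm₁
  have := hv.isNoetherianRing_chartRing_ray (k := k)
  rw [ringKrullDim_ofPrime, height_eq_one_of_eq_span (π := ⟨chi k m₁, hmem⟩)
    (fun h => chi_ne_zero m₁ (congrArg Subtype.val h)) hspan]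
  rfl

/-- If `χ^m = c / d` with `m v < 0`, then all weights of `c = χ^m d` being nonnegative forces those
of `d` to be positive, so `d` lies in the prime and is not an allowed denominator. -/
theorem chi_mem_toricPrime {v : N} (hv : Unimodular {v}) {O : LocalSubring (FunctionField k N)}
    (hO : IsLocalRingOfToricPrime v O) {m : DualLattice N} :
    chi k m ∈ O.toSubring ↔ 0 ≤ m v := by
  obtain ⟨hprime, rfl⟩ := hO
  constructor
  · intro h
    by_contra! hlt
    obtain ⟨⟨y, hy⟩, ⟨s, hs⟩, hsP, hys⟩ := mem_ofPrime.1 h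
    obtain ⟨c, hc, rfl⟩ := mem_chartRing.1 hy
    obtain ⟨d, hd, rfl⟩ := mem_chartRing.1 hs
    have hd0 : fromTorus k N d ≠ 0 := fun h0 => hsP (by
      rw [mk_fromTorus_mem_orbitIdeal hv, fromTorus_injective (h0.trans (map_zero _).symm)]
      exact suppIn_zero _)
    rw [mk_fromTorus_mem_orbitIdeal hv] at hsP
    apply hsP
    have : AddMonoidAlgebra.single m 1 * d = c := by
      apply fromTorus_injective
      rw [map_mul, ← chi_eq, hys]
      exact div_mul_cancel₀ _ hd0
    rw [← this, suppIn_single_mul] at hc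
    refine hc.mono fun m' hm' => ?_
    have := mem_dualPoints_ray.1 hm'
    simp only [LinearMap.add_apply] at this
    change 1 ≤ m' v
    omega
  · intro h
    exact LocalSubring.le_ofPrime _ _ (chi_mem_chartRing (mem_dualPoints_ray.2 h))

/-- By `chi_mem_toricPrime` the local ring determines the half-space `{m | 0 ≤ m v}`. Forms
vanishing on `v` thus vanish on `w`, so `w` is a multiple of `v`; primitivity and the sign make the
multiple 1. -/
theorem toricPrime_unique [Module.Free ℤ N] {v w : N} (hv : Unimodular {v}) (hw : Unimodular {w})
    {O : LocalSubring (FunctionField k N)} (hvO : IsLocalRingOfToricPrime v O)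
    (hwO : IsLocalRingOfToricPrime w O) : w = v := by
  have key : ∀ m : DualLattice N, 0 ≤ m v ↔ 0 ≤ m w := fun m => by
    rw [← chi_mem_toricPrime hv hvO, chi_mem_toricPrime hw hwO]
  obtain ⟨m₁, hm₁, -⟩ := hv.exists_dual (Finset.mem_singleton_self v)
  have h1 : ∀ m : DualLattice N, m w = m₁ w * m v := by
    intro m
    have h2 := (key (m - m v • m₁)).1 (by simp [hm₁])
    have h3 := (key (-(m - m v • m₁))).1 (by simp [hm₁])
    simp only [LinearMap.neg_apply, LinearMap.sub_apply, LinearMap.smul_apply, smul_eq_mul] at h2 h3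
    linarith [mul_comm (m₁ w) (m v)]
  have h4 : w = m₁ w • v := by
    refine (Module.Free.chooseBasis ℤ N).ext_elem fun i => ?_
    have := h1 ((Module.Free.chooseBasis ℤ N).coord i)
    simpa using this
  have h5 := Int.isUnit_iff.1 (hw.isPrimitive (Finset.mem_singleton_self w) _ _ h4)
  have h6 : 0 ≤ m₁ w := (key m₁).1 (by omega)
  have h7 : m₁ w = 1 := by omega
  rw [h4, h7, one_smul]

end ToricPrime

/-! ### Factoriality of the Laurent polynomial ring `k[M]` -/

section Factoriality

variable {k : Type*} [Field k] {N : Type*} [AddCommGroup N]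

theorem exists_shift {ι : Type*} (b : Module.Basis ι ℤ N) (T : Finset (DualLattice N)) :
    ∃ d : ι → ℕ, ∀ t ∈ T, ∀ i, 0 ≤ (d i : ℤ) + t (b i) := by
  refine ⟨fun i => ∑ t ∈ T, (t (b i)).natAbs, fun t ht i => ?_⟩
  have := Finset.single_le_sum (f := fun t : DualLattice N => (t (b i)).natAbs)
    (fun _ _ => Nat.zero_le _) ht
  beta_reduce
  omega

/-- The embedding of monomials in nonnegative exponents into the dual lattice. -/
def exponentHom {ι : Type*} [Finite ι] (b : Module.Basis ι ℤ N) :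
    (ι →₀ ℕ) →+ DualLattice N where
  toFun d := b.constr ℤ fun i => (d i : ℤ)
  map_zero' := b.ext fun i => by simp
  map_add' d e := b.ext fun i => by simp

theorem exponentHom_apply {ι : Type*} [Finite ι] (b : Module.Basis ι ℤ N) (d : ι →₀ ℕ) (i : ι) :
    exponentHom b d (b i) = d i := by
  simp [exponentHom]

theorem exponentHom_injective {ι : Type*} [Finite ι] (b : Module.Basis ι ℤ N) :
    Function.Injective (exponentHom b) := by
  intro d e h
  ext i
  have := congrArg (fun m : DualLattice N => m (b i)) h
  simpa [exponentHom_apply] using this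

/-- A basis of `N` exhibits `k[M]` as the localization of a polynomial ring at its monomials, and
localization preserves unique factorization. -/
theorem uniqueFactorizationMonoid_torus [Module.Free ℤ N] [Module.Finite ℤ N] :
    UniqueFactorizationMonoid (AddMonoidAlgebra k (DualLattice N)) := by
  let b := Module.Free.chooseBasis ℤ N
  let ι := Module.Free.ChooseBasisIndex ℤ N
  let φ : AddMonoidAlgebra k (ι →₀ ℕ) →+* AddMonoidAlgebra k (DualLattice N) :=
    AddMonoidAlgebra.mapDomainRingHom k (exponentHom b)
  have hφ : ∀ d r, φ (AddMonoidAlgebra.single d r) =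
      AddMonoidAlgebra.single (exponentHom b d) r := fun d r => by
    simp [φ]
  have hinj : Function.Injective φ :=
    AddMonoidAlgebra.mapDomain_injective (exponentHom_injective b)
  have hrange : ∀ a : AddMonoidAlgebra k (DualLattice N), SuppIn {m | ∀ i, 0 ≤ m (b i)} a →
      a ∈ φ.range := by
    intro a ha
    rw [← AddMonoidAlgebra.sum_coeff_single a, Finsupp.sum]
    refine sum_mem fun m hm => ?_
    refine ⟨AddMonoidAlgebra.single (Finsupp.equivFunOnFinite.symm fun i => (m (b i)).toNat)
      (a.coeff m), ?_⟩
    rw [hφ]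
    congr 1
    refine b.ext fun i => ?_
    rw [exponentHom_apply]
    have := ha m hm i
    simpa using this
  let S : Submonoid (AddMonoidAlgebra k (ι →₀ ℕ)) := MonoidHom.mrange (AddMonoidAlgebra.of k _)
  let _ : Algebra (AddMonoidAlgebra k (ι →₀ ℕ)) (AddMonoidAlgebra k (DualLattice N)) := φ.toAlgebra
  have hloc : IsLocalization S (AddMonoidAlgebra k (DualLattice N)) := by
    refine ⟨?_, ?_, ?_⟩
    · rintro ⟨_, d, rfl⟩
      refine IsUnit.of_mul_eq_one (AddMonoidAlgebra.single (-exponentHom b d.toAdd) 1) ?_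
      change φ (AddMonoidAlgebra.single d.toAdd 1) * _ = 1
      rw [hφ, AddMonoidAlgebra.single_mul_single, add_neg_cancel, mul_one,
        ← AddMonoidAlgebra.one_def]
    · intro a
      obtain ⟨d, hd⟩ := exists_shift b a.coeff.support
      let d' : ι →₀ ℕ := Finsupp.equivFunOnFinite.symm d
      obtain ⟨y, hy⟩ := hrange (AddMonoidAlgebra.single (exponentHom b d') 1 * a) (by
        rw [suppIn_single_mul]
        intro m hm i
        rw [LinearMap.add_apply, exponentHom_apply]
        exact hd m hm i)
      refine ⟨⟨y, ⟨_, Multiplicative.ofAdd d', rfl⟩⟩, ?_⟩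
      change a * φ (AddMonoidAlgebra.single d' 1) = φ y
      rw [hφ, hy, mul_comm]
    · intro x y h
      exact ⟨1, by rw [hinj h]⟩
  have : UniqueFactorizationMonoid (AddMonoidAlgebra k (ι →₀ ℕ)) :=
    inferInstanceAs (UniqueFactorizationMonoid (MvPolynomial ι k))
  exact UniqueFactorizationMonoid.of_isLocalization S _

end Factoriality

/-! ### Classification of prime divisors -/

section PrimeDivisors

variable {k : Type*} [Field k] {N : Type*} [AddCommGroup N]

/-- The characters of the chart are products of generators; those off `A` are units, and the others
are the coordinate characters of members of `A`. If `P` contains none of the latter, it contains no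
character at all, so all characters become invertible in the local ring. -/
theorem chi_mem_ofPrime_or {A : Finset N} (hA : Unimodular A)
    {P : Ideal (chartRing k (cone A))} [P.IsPrime] :
    (∀ m, chi k m ∈ (LocalSubring.ofPrime (chartRing k (cone A)) P).toSubring) ∨
      ∃ a ∈ A, ∃ m₁ : DualLattice N, m₁ a = 1 ∧ (∀ w ∈ A, w ≠ a → m₁ w = 0) ∧
        ∃ h : chi k m₁ ∈ chartRing k (cone A), ⟨chi k m₁, h⟩ ∈ P := by
  obtain ⟨b, hb⟩ := hA
  by_cases hex : ∃ i, b i ∈ A ∧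
      ∃ h : chi k (b.coord i) ∈ chartRing k (cone A), ⟨chi k (b.coord i), h⟩ ∈ P
  · obtain ⟨i, hi, h, hP⟩ := hex
    refine Or.inr ⟨b i, hi, b.coord i, by simp, fun w hw hne => ?_, h, hP⟩
    obtain ⟨j, rfl⟩ := hb hw
    have : j ≠ i := fun h => hne (by rw [h])
    simp [this]
  · left
    have hgen : ∀ m ∈ dualPoints (cone A), ∀ h : chi k m ∈ chartRing k (cone A),
        (⟨chi k m, h⟩ : chartRing k (cone A)) ∉ P := by
      intro m hm
      have hm' := hm
      rw [← closure_dualGenerators b hb] at hm'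
      refine AddSubmonoid.closure_induction (motive := fun m _ => ∀ h : chi k m ∈
        chartRing k (cone A), (⟨chi k m, h⟩ : chartRing k (cone A)) ∉ P) ?_ ?_ ?_ hm'
      · have hunit : ∀ m m' : DualLattice N, m ∈ dualPoints (cone A) →
            m' ∈ dualPoints (cone A) → m + m' = 0 → ∀ h : chi k m ∈ chartRing k (cone A),
            (⟨chi k m, h⟩ : chartRing k (cone A)) ∉ P := by
          intro m m' hm hm' h0 h hP
          refine (Ideal.ne_top_iff_one P).1 Ideal.IsPrime.ne_top' ?_
          have := P.mul_mem_right ⟨chi k m', chi_mem_chartRing hm'⟩ hP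
          convert this
          apply Subtype.ext
          change 1 = chi k m * chi k m'
          rw [← chi_add, h0, chi_zero]
        have hsub : dualGenerators b A ⊆ dualPoints (cone A) := by
          rw [← closure_dualGenerators b hb]
          exact AddSubmonoid.subset_closure
        rintro m (⟨i, rfl⟩ | ⟨i, hi, rfl⟩) h hP
        · by_cases hi : b i ∈ A
          · exact hex ⟨i, hi, h, hP⟩
          · exact hunit (b.coord i) (-b.coord i) (hsub (Or.inl ⟨i, rfl⟩))
              (hsub (Or.inr ⟨i, hi, rfl⟩)) (add_neg_cancel _) h hP
        · exact hunit (-b.coord i) (b.coord i) (hsub (Or.inr ⟨i, hi, rfl⟩))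
            (hsub (Or.inl ⟨i, rfl⟩)) (neg_add_cancel _) h hP
      · intro h hP
        refine (Ideal.ne_top_iff_one P).1 Ideal.IsPrime.ne_top' ?_
        have h1 : (⟨chi k 0, h⟩ : chartRing k (cone A)) = 1 := Subtype.ext chi_zero
        rwa [h1] at hP
      · intro m m' hm hm' h h' hmm hP
        have hmc : m ∈ dualPoints (cone A) := closure_dualGenerators b hb ▸ hm
        have hmc' : m' ∈ dualPoints (cone A) := closure_dualGenerators b hb ▸ hm'
        have : (⟨chi k (m + m'), hmm⟩ : chartRing k (cone A)) =
            ⟨chi k m, chi_mem_chartRing hmc⟩ * ⟨chi k m', chi_mem_chartRing hmc'⟩ :=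
          Subtype.ext (chi_add m m')
        rw [this] at hP
        exact (Ideal.IsPrime.mem_or_mem ‹_› hP).elim (h _) (h' _)
    intro m
    -- Any character is a quotient of two characters of the chart.
    obtain ⟨d, hd⟩ := exists_shift b {m}
    let m' : DualLattice N := b.constr ℤ fun i => (d i : ℤ)
    have hm' : m' ∈ dualPoints (cone A) := mem_dualPoints_cone.2 fun a ha => by
      obtain ⟨i, rfl⟩ := hb ha
      simp [m']
    have hmm' : m' + m ∈ dualPoints (cone A) := mem_dualPoints_cone.2 fun a ha => by
      obtain ⟨i, rfl⟩ := hb ha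
      simpa [m'] using hd m (Finset.mem_singleton_self m) i
    refine mem_ofPrime.2 ⟨⟨_, chi_mem_chartRing hmm'⟩, ⟨_, chi_mem_chartRing hm'⟩,
      hgen _ hm' _, ?_⟩
    change chi k m = chi k (m' + m) / chi k m'
    rw [chi_add, mul_div_cancel_left₀ _ (chi_ne_zero (k := k) m')]

/-- The generic point of `D_a` already lies in the smaller chart of the ray, so both charts give the
same local ring. -/
theorem isLocalRingOfToricPrime_ofPrime {A : Finset N} (hA : Unimodular A) {a : N} (ha : a ∈ A)
    {P : Ideal (chartRing k (cone A))} [P.IsPrime]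
    (hP : P = divisorIdeal k (cone A) a (toNR_mem_cone ha)) :
    IsLocalRingOfToricPrime a (LocalSubring.ofPrime (chartRing k (cone A)) P) := by
  have hua : Unimodular {a} := hA.mono (by simpa using ha)
  have hprime := orbitIdeal_ray_isPrime (k := k) hua
  refine ⟨hprime, LocalSubring.toSubring_injective (SetLike.ext fun x => ?_)⟩
  have hmemP : ∀ (c : AddMonoidAlgebra k (DualLattice N)) (hc),
      (⟨fromTorus k N c, hc⟩ : chartRing k (cone A)) ∈ P ↔ SuppIn {m | 1 ≤ m a} c := by
    intro c hc
    rw [hP, mk_fromTorus_mem_divisorIdeal]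
  rw [mem_ofPrime, mem_ofPrime]
  constructor
  · rintro ⟨⟨y, hy⟩, ⟨s, hs⟩, hsP, rfl⟩
    obtain ⟨c, hc, rfl⟩ := mem_chartRing.1 hy
    obtain ⟨d, hd, rfl⟩ := mem_chartRing.1 hs
    have hsub : dualPoints (cone A) ⊆ dualPoints (ray a) := fun m hm =>
      mem_dualPoints_ray.2 (mem_dualPoints_cone.1 hm a ha)
    refine ⟨⟨_, fromTorus_mem_chartRing.2 (hc.mono hsub)⟩,
      ⟨_, fromTorus_mem_chartRing.2 (hd.mono hsub)⟩, ?_, rfl⟩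
    rw [mk_fromTorus_mem_orbitIdeal hua]
    rwa [hmemP] at hsP
  · rintro ⟨⟨y, hy⟩, ⟨s, hs⟩, hsP, rfl⟩
    obtain ⟨c, hc, rfl⟩ := mem_chartRing.1 hy
    obtain ⟨d, hd, rfl⟩ := mem_chartRing.1 hs
    rw [mk_fromTorus_mem_orbitIdeal hua] at hsP
    classical
    obtain ⟨b, hb⟩ := hA
    obtain ⟨e, he⟩ := exists_shift b (c.coeff.support ∪ d.coeff.support)
    -- A character of weight 0 at `a` and large at the other generators: it brings numerator and
    -- denominator into the chart of `cone A` without changing their weights along `a`.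
    let m' : DualLattice N := b.constr ℤ fun i => if b i = a then 0 else (e i : ℤ)
    have hm' : ∀ i, m' (b i) = if b i = a then 0 else (e i : ℤ) := fun i =>
      b.constr_basis ℤ _ i
    have hm'a : m' a = 0 := by
      obtain ⟨i, rfl⟩ := hb ha
      rw [hm', if_pos rfl]
    have hshift : ∀ t ∈ c.coeff.support ∪ d.coeff.support, 0 ≤ t a →
        m' + t ∈ dualPoints (cone A) := by
      intro t ht hta
      refine mem_dualPoints_cone.2 fun w hw => ?_
      by_cases hwa : w = a
      · rw [hwa, LinearMap.add_apply, hm'a, zero_add]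
        exact hta
      · obtain ⟨i, rfl⟩ := hb hw
        have := he t ht i
        rwa [LinearMap.add_apply, hm', if_neg hwa]
    have hc' : SuppIn (dualPoints (cone A)) (AddMonoidAlgebra.single m' 1 * c) := by
      rw [suppIn_single_mul]
      intro m hm
      exact hshift m (Finset.mem_union_left _ hm) (mem_dualPoints_ray.1 (hc m hm))
    have hd' : SuppIn (dualPoints (cone A)) (AddMonoidAlgebra.single m' 1 * d) := by
      rw [suppIn_single_mul]
      intro m hm
      exact hshift m (Finset.mem_union_right _ hm) (mem_dualPoints_ray.1 (hd m hm))
    refine ⟨⟨_, fromTorus_mem_chartRing.2 hc'⟩, ⟨_, fromTorus_mem_chartRing.2 hd'⟩, ?_, ?_⟩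
    · rw [hmemP, suppIn_single_mul]
      simpa [hm'a] using hsP
    · change _ = fromTorus k N _ / fromTorus k N _
      rw [map_mul, map_mul, ← chi_eq, mul_div_mul_left _ _ (chi_ne_zero m')]

theorem Fan.unimodular_of_mem_rays [Module.Free ℤ N] {S : Fan N} (hS : S.IsSmooth) {v : N}
    (hv : v ∈ S.rays) : Unimodular {v} := by
  obtain ⟨K, rfl⟩ := SmoothComplex.exists_toFan_eq hS ⟨_, hv.2⟩
  exact K.unimodular _ (K.mem_rays_toFan.1 hv)

theorem PrimeDivisor.isNoetherianRing {S : Fan N} (hS : S.IsSmooth) (E : PrimeDivisor k S) :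
    IsNoetherianRing E.1.toSubring := by
  obtain ⟨O, ⟨σ, hσ, P, hP, rfl⟩, h⟩ := E
  obtain ⟨A, hA, rfl⟩ := SmoothComplex.exists_eq_cone hS hσ
  have := hA.isNoetherianRing_chartRing (k := k)
  exact isNoetherianRing_ofPrime _ _

/-- A prime divisor either meets the torus or is toric. -/
theorem PrimeDivisor.chi_mem_or_toric {S : Fan N} (hS : S.IsSmooth) (E : PrimeDivisor k S) :
    (∀ m, chi k m ∈ E.1.toSubring) ∨ ∃ v : S.rays, IsLocalRingOfToricPrime (v : N) E.1 := by
  obtain ⟨O, ⟨σ, hσ, P, hP, rfl⟩, h⟩ := E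
  obtain ⟨A, hA, rfl⟩ := SmoothComplex.exists_eq_cone hS hσ
  refine (chi_mem_ofPrime_or hA (P := P)).imp id ?_
  rintro ⟨a, ha, m₁, h1, h0, hm, hmP⟩
  have hray : a ∈ S.rays := ⟨hA.isPrimitive ha, by
    rw [ray_eq_cone]
    exact S.face_mem _ hσ _ (hA.cone_isFaceOf (by simpa using ha))⟩
  refine ⟨⟨a, hray⟩, isLocalRingOfToricPrime_ofPrime hA ha ?_⟩
  -- The divisor ideal of `a` is a nonzero prime inside `P`, and `P` has height one, so the two
  -- coincide.
  have hspan := divisorIdeal_eq_span rfl (toNR_mem_cone ha) h1 h0 hm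
  have := divisorIdeal_isPrime (k := k) (cone A) a (toNR_mem_cone ha)
  symm
  refine eq_of_le_of_height_eq_one ?_ ?_ ?_
  · intro hbot
    rw [hspan, Ideal.span_singleton_eq_bot] at hbot
    exact chi_ne_zero m₁ (congrArg Subtype.val hbot)
  · rw [hspan, Ideal.span_singleton_le_iff_mem]
    exact hmP
  · rw [ringKrullDim_ofPrime] at h
    exact_mod_cast h

theorem not_toric_of_chi_mem {v : N} (hv : Unimodular {v}) {O : LocalSubring (FunctionField k N)}
    (h : ∀ m, chi k m ∈ O.toSubring) : ¬ IsLocalRingOfToricPrime v O := by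
  intro hO
  obtain ⟨m, hm, -⟩ := hv.exists_dual (Finset.mem_singleton_self v)
  have := (chi_mem_toricPrime hv hO).1 (h (-m))
  simp [hm] at this

theorem toWeilDiv_of_chi_mem [Module.Free ℤ N] {S : Fan N} (hS : S.IsSmooth) (D : S.ToricDiv ℤ)
    (E : PrimeDivisor k S) (h : ∀ m, chi k m ∈ E.1.toSubring) : toWeilDiv k D E = 0 := by
  rw [toWeilDiv]
  refine (finsum_congr fun v => ?_).trans finsum_zero
  exact if_neg (not_toric_of_chi_mem (Fan.unimodular_of_mem_rays hS v.2) h)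

theorem toWeilDiv_of_toric [Module.Free ℤ N] {S : Fan N} (hS : S.IsSmooth) (D : S.ToricDiv ℤ)
    (E : PrimeDivisor k S) {v : S.rays} (h : IsLocalRingOfToricPrime (v : N) E.1) :
    toWeilDiv k D E = D v := by
  rw [toWeilDiv, finsum_eq_single _ v, if_pos h]
  intro w hw
  refine if_neg fun hwE => hw (Subtype.ext ?_)
  exact toricPrime_unique (Fan.unimodular_of_mem_rays hS v.2) (Fan.unimodular_of_mem_rays hS w.2)
    h hwE

end PrimeDivisors

/-! ### Global sections -/

section GlobalSections

variable {k : Type*} [Field k] {N : Type*} [AddCommGroup N]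

theorem dualPoints_cone_empty : dualPoints (cone (∅ : Finset N)) = Set.univ :=
  Set.eq_univ_of_forall fun _ => mem_dualPoints_cone.2 (by simp)

theorem fromTorus_mem_torusChart (a : AddMonoidAlgebra k (DualLattice N)) :
    fromTorus k N a ∈ chartRing k (cone (∅ : Finset N)) := by
  rw [fromTorus_mem_chartRing, dualPoints_cone_empty]
  exact fun _ _ => Set.mem_univ _

/-- The coordinate ring of the torus is the chart ring of the zero cone. -/
def torusChartEquiv (k : Type*) [Field k] (N : Type*) [AddCommGroup N] :
    AddMonoidAlgebra k (DualLattice N) ≃+* chartRing k (cone (∅ : Finset N)) :=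
  RingEquiv.ofBijective
    ((fromTorus k N).toRingHom.codRestrict (chartRing k (cone (∅ : Finset N)))
      fromTorus_mem_torusChart)
    ⟨fun _ _ h => fromTorus_injective (congrArg Subtype.val h), fun ⟨x, hx⟩ => by
      obtain ⟨a, -, rfl⟩ := mem_chartRing.1 hx
      exact ⟨a, rfl⟩⟩

/-- The zero cone belongs to every nonempty fan, so the torus is a chart, and the principal prime
`(p)` of `k[M]` is a point of codimension one in it. -/
theorem exists_primeDivisor_torus [Module.Free ℤ N] {S : Fan N} (hS : S.IsSmooth)
    (hne : S.cones.Nonempty) {p : AddMonoidAlgebra k (DualLattice N)} (hp : Prime p) :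
    ∃ E : PrimeDivisor k S, (∀ m, chi k m ∈ E.1.toSubring) ∧
      ∀ a b, ¬ p ∣ a → ¬ p ∣ b → ∀ r : ℤ,
        ordAlong E.1.toSubring (fromTorus k N p ^ r * (fromTorus k N a / fromTorus k N b)) = r := by
  obtain ⟨σ, hσ⟩ := hne
  obtain ⟨A, hA, rfl⟩ := SmoothComplex.exists_eq_cone hS hσ
  have h0 : cone ∅ ∈ S.cones := S.face_mem _ hσ _ (hA.cone_isFaceOf (Finset.empty_subset A))
  have := (hA.mono (Finset.empty_subset A)).isNoetherianRing_chartRing (k := k)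
  let e := torusChartEquiv k N
  have hep : Prime (e p) := (MulEquiv.prime_iff e.toMulEquiv).2 hp
  let P := Ideal.span {e p}
  have hP : P.IsPrime := (Ideal.span_singleton_prime hep.ne_zero).2 hep
  refine ⟨⟨LocalSubring.ofPrime _ P, ⟨_, h0, P, hP, rfl⟩, ?_⟩, fun m => ?_, fun a b ha hb r => ?_⟩
  · rw [ringKrullDim_ofPrime, height_eq_one_of_eq_span hep.ne_zero rfl]
    rfl
  · exact LocalSubring.le_ofPrime _ _ (fromTorus_mem_torusChart _)
  · have hmem : ∀ a, ¬ p ∣ a → e a ∉ P := by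
      intro a ha h
      rw [Ideal.mem_span_singleton] at h
      exact ha ((map_dvd_iff e).1 h)
    exact ordAlong_ofPrime_span hep.ne_zero rfl (hmem a ha) (hmem b hb) r

/-- In a reduced fraction, an irreducible factor `p` of the denominator with multiplicity `n ≥ 1`
would give a divisor meeting the torus along which `f` has order `-n`. The denominator is therefore
a unit. -/
theorem exists_fromTorus_eq [Module.Free ℤ N] [Module.Finite ℤ N] {S : Fan N} (hS : S.IsSmooth)
    (hne : S.cones.Nonempty) {f : FunctionField k N}
    (h : ∀ E : PrimeDivisor k S, (∀ m, chi k m ∈ E.1.toSubring) →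
      0 ≤ ordAlong E.1.toSubring f) : ∃ a, fromTorus k N a = f := by
  have := uniqueFactorizationMonoid_torus (k := k) (N := N)
  obtain ⟨a, b, hab, hfab⟩ := IsFractionRing.exists_reduced_fraction
    (A := AddMonoidAlgebra k (DualLattice N)) f
  have hb0 : (b : AddMonoidAlgebra k (DualLattice N)) ≠ 0 := nonZeroDivisors.ne_zero b.2
  have hbF : fromTorus k N b ≠ 0 := (map_ne_zero_iff _ fromTorus_injective).2 hb0
  have hfab' : f = fromTorus k N a / fromTorus k N b := by
    rw [← hfab, IsFractionRing.mk'_eq_div]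
    rfl
  by_cases hbu : IsUnit (b : AddMonoidAlgebra k (DualLattice N))
  · obtain ⟨u, hu⟩ := hbu
    refine ⟨a * (u⁻¹ : (AddMonoidAlgebra k (DualLattice N))ˣ), ?_⟩
    rw [hfab', eq_div_iff hbF, ← map_mul, ← hu, mul_assoc, Units.inv_mul, mul_one]
  · obtain ⟨p, hp, hpb⟩ := WfDvdMonoid.exists_irreducible_factor hbu hb0
    have hpp := UniqueFactorizationMonoid.irreducible_iff_prime.1 hp
    have hpa : ¬ p ∣ a := fun hpa => hp.not_isUnit (hab hpa hpb)
    obtain ⟨n, b', hpb', hb'⟩ := WfDvdMonoid.max_power_factor hb0 hp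
    obtain ⟨E, hE, hord⟩ := exists_primeDivisor_torus hS hne hpp
    have h1 := h E hE
    have hn : n ≠ 0 := by
      rintro rfl
      rw [pow_zero, one_mul] at hb'
      exact hpb' (hb' ▸ hpb)
    have h2 : f = fromTorus k N p ^ (-(n : ℤ)) * (fromTorus k N a / fromTorus k N b') := by
      rw [hfab', hb', map_mul, map_pow, zpow_neg, zpow_natCast, ← div_eq_inv_mul, div_div,
        mul_comm]
    rw [h2, hord a b' hpa hpb'] at h1
    omega

theorem fromTorus_mem_of_chi_mem {σ : PointedCone ℝ (NR N)} {P : Ideal (chartRing k σ)} [P.IsPrime]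
    (h : ∀ m, chi k m ∈ (LocalSubring.ofPrime (chartRing k σ) P).toSubring)
    (a : AddMonoidAlgebra k (DualLattice N)) :
    fromTorus k N a ∈ (LocalSubring.ofPrime (chartRing k σ) P).toSubring := by
  rw [← AddMonoidAlgebra.sum_coeff_single a, Finsupp.sum, map_sum]
  refine sum_mem fun m _ => ?_
  rw [fromTorus_single, Algebra.smul_def]
  refine mul_mem (LocalSubring.le_ofPrime _ _ ?_) (h m)
  exact Subalgebra.algebraMap_mem (Algebra.adjoin k (chi k '' dualPoints σ)) _

theorem exists_primeDivisor_toric [Module.Free ℤ N] {S : Fan N} (hS : S.IsSmooth) (v : S.rays) :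
    ∃ E : PrimeDivisor k S, IsLocalRingOfToricPrime (v : N) E.1 := by
  have hv := Fan.unimodular_of_mem_rays hS v.2
  have hprime := orbitIdeal_ray_isPrime (k := k) hv
  have hO : IsLocalRingOfToricPrime (v : N) (LocalSubring.ofPrime _ (orbitIdeal k (ray (v : N)))) :=
    ⟨hprime, rfl⟩
  exact ⟨⟨_, ⟨_, v.2.2, _, hprime, rfl⟩, ringKrullDim_toricPrime hv hO⟩, hO⟩

/-- Since `m v` is an integer, `-m v ≤ a_v` and `-m v ≤ ⌊a_v⌋` are equivalent. -/
theorem toMR_mem_Delta {S : Fan N} {D : ToricBDivisor S} {m : DualLattice N} :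
    toMR m ∈ D.Delta ↔ ∀ (S' : S.R) (v : S'.1.rays), 0 ≤ m v + ⌊D.inc S' v⌋ := by
  simp only [ToricBDivisor.Delta, Set.mem_iInter, Fan.polyhedron, Set.mem_ofPred_eq,
    pairing_toMR_toNR]
  refine forall_congr' fun S' => forall_congr' fun v => ?_
  have h1 : (-(D.inc S' v : ℝ) ≤ (m v : ℝ)) ↔ ((-m v : ℤ) : ℚ) ≤ D.inc S' v := by
    rw [neg_le]
    push_cast
    exact_mod_cast Iff.rfl
  rw [h1, ← Int.le_floor]
  omega

theorem ToricBDivisor.globalSections_eq [Module.Free ℤ N] [Module.Finite ℤ N] {S : Fan N}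
    (hsmooth : S.IsSmooth) (hne : S.cones.Nonempty) (D : ToricBDivisor S) :
    D.globalSections k = (Submodule.span k (chi k '' {m | toMR m ∈ D.Delta}) :
        Set (FunctionField k N)) := by
  ext f
  rw [SetLike.mem_coe, mem_span_chi]
  have hnonneg : (0 ≤ bdiv S f + D.floor k) ↔ ∀ (S' : S.R) (E : PrimeDivisor k S'.1),
      0 ≤ ordAlong E.1.toSubring f + toWeilDiv k (fun v => ⌊D.inc S' v⌋) E := Iff.rfl
  simp only [ToricBDivisor.globalSections, Set.mem_union, Set.mem_ofPred_eq,
    Set.mem_singleton_iff, hnonneg]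
  constructor
  · rintro (⟨hf, h⟩ | rfl)
    -- The model `Σ` alone shows that `f` is a Laurent polynomial; the other models only constrain
    -- its exponents.
    · obtain ⟨a, rfl⟩ := exists_fromTorus_eq hsmooth hne fun E hE => by
        have := h ⟨S, hsmooth, .refl S⟩ E
        rwa [toWeilDiv_of_chi_mem hsmooth _ E hE, add_zero] at this
      refine ⟨a, fun m hm => toMR_mem_Delta.2 fun S' v => ?_, rfl⟩
      have ha : a ≠ 0 := by
        rintro rfl
        simp at hm
      obtain ⟨E, hE⟩ := exists_primeDivisor_toric (k := k) S'.2.1 v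
      have h1 := h S' E
      rw [toWeilDiv_of_toric S'.2.1 _ E hE] at h1
      -- The order is attained at the exponent of least weight, so the bound holds for every
      -- exponent `m`.
      obtain ⟨m₀, -, hmin, hord⟩ :=
        ordAlong_toricPrime (Fan.unimodular_of_mem_rays S'.2.1 v.2) hE ha
      have h2 := hmin m hm
      rw [hord] at h1
      omega
    · exact ⟨0, suppIn_zero _, map_zero _⟩
  · rintro ⟨a, ha, rfl⟩
    by_cases ha0 : a = 0
    · right
      rw [ha0, map_zero]
    have hf : fromTorus k N a ≠ 0 := (map_ne_zero_iff _ fromTorus_injective).2 ha0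
    refine Or.inl ⟨hf, fun S' E => ?_⟩
    -- Along divisors meeting the torus a Laurent polynomial is regular; along toric ones its order
    -- is the weight of one of its exponents, each of which lies in `Δ_D`.
    rcases E.chi_mem_or_toric S'.2.1 with h | ⟨v, hv⟩
    · rw [toWeilDiv_of_chi_mem S'.2.1 _ E h, add_zero]
      have := E.isNoetherianRing S'.2.1
      have := krullDimLE_one_of_eq E.2.2
      refine ordAlong_nonneg _ ?_ hf
      obtain ⟨O, ⟨σ, hσ, P, hP, rfl⟩, hdim⟩ := E
      exact fromTorus_mem_of_chi_mem h a
    · rw [toWeilDiv_of_toric S'.2.1 _ E hv]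
      obtain ⟨m, hm, -, hord⟩ :=
        ordAlong_toricPrime (Fan.unimodular_of_mem_rays S'.2.1 v.2) hv ha0
      rw [hord]
      exact toMR_mem_Delta.1 (ha m hm) S' v

end GlobalSections

end

end ToricB

open ToricB in
theorem mainTheorem6 {k : Type*} [Field k] [IsAlgClosed k]
    {N : Type*} [AddCommGroup N] [Module.Free ℤ N] [Module.Finite ℤ N]
    (S : Fan N) (hsmooth : S.IsSmooth) (hcomplete : S.IsComplete) (D : ToricBDivisor S) :
    D.globalSections k = (Submodule.span k (chi k '' {m | toMR m ∈ D.Delta}) :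
        Set (FunctionField k N)) ∧
      LinearIndependent k (fun m : {m : DualLattice N // toMR m ∈ D.Delta} => chi k m.1) ∧
      D.Delta = {m : MR N | ∀ v : N, IsPrimitive v →
        (D.phi v : ℝ) ≤ pairing N m (toNR v)} :=
  ⟨D.globalSections_eq hsmooth hcomplete.nonempty,
    linearIndependent_chi.comp _ Subtype.val_injective, D.Delta_eq hsmooth hcomplete⟩
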